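/- **Proposition (Asymptotic distribution).** *Setting.* Let $\mathcal X\subset\mathbb R^d$ be contained in the closure of its interior, $\mathcal Y\subset\mathbb R$, $\mathcal Z=\mathcal X\times\mathcal Y$ and $s\in\mathbb N=\{0,1,\dots\}$. For a multi-index $\beta\in\mathbb N^d$ put $|\beta|=\beta_1+\dots+\beta_d$, and let $\mathcal A_s=\{\beta:|\beta|\le s\}$. A function belongs to $C^m$ of such a set if it is continuous on the set, is $C^m$ in the interior, and its derivatives of order at most $m$ extend continuously from the interior to the set; at non-interior points $D^\beta f$ denotes the extended partial derivative. Let $\mathcal H$ be a real reproducing kernel Hilbert space of functions on $\mathcal X$ whose kernel satisfies $K\in C^{2s}(\mathcal X\times\mathcal X)$, and for $\beta\in\mathcal A_s$ let $\phi^{(\beta)}(x)=D^\beta_x K(x,\cdot)$. For measurable weights $w_\beta:\mathcal Z\to\mathbb R$ put, for $z=(x,y)$, $$\mathcal R(h;z)=\sum_{\beta\in\mathcal A_s}w_\beta(z)\,D^\beta h(x),\qquad \psi(z)=\sum_{\beta\in\mathcal A_s}w_\beta(z)\,\phi^{(\beta)}(x).$$ Let $P$ be a probability measure on $\mathcal Z$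 with $\mathbb E_P\|\psi\|^4<\infty$, and let $z_1,z_2,\dots$ be random variables with law $P$ such that the random elements $\psi(z_1),\psi(z_2),\dots$ of $\mathcal H$ are independent (for instance, $z_1,z_2,\dots$ i.i.d. with law $P$). For $\lambda>0$ let $$h_\lambda=\operatorname*{argmin}_{h\in\mathcal H}\Big\{-\mathbb E_P[\mathcal R(h;z)]+\tfrac12\mathbb V_P[\mathcal R(h;z)]+\tfrac\lambda2\|h\|^2\Big\},$$ and let $\hat h_\lambda$ be the minimizer of the same functional with $P$ replaced by the empirical distribution $\frac1N\sum_{i=1}^N\delta_{z_i}$. Write $(f\otimes g)u=\langle u,g\rangle f$ and $$\mu=\mathbb E_P[\psi],\quad \Sigma=\mathbb E_P[(\psi-\mu)\otimes(\psi-\mu)],\quad \Sigma_\lambda=\Sigma+\lambda I,$$ $$F=(\psi-\mu)-\big((\psi-\mu)\otimes(\psi-\mu)-\Sigma\big)h_\lambda,\quad Q_\lambda=\mathbb E_P[F\otimes F].$$ *Claim.* All these objects are well defined: $\mathcal H\subset C^s(\mathcal X)$; for $\beta\in\mathcal A_s$ and $x\in\mathcal X$ one has $\phi^{(\beta)}(x)\in\mathcal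 H$ and $D^\beta h(x)=\langle h,\phi^{(\beta)}(x)\rangle$ for all $h\in\mathcal H$; and the minimizers $h_\lambda,\hat h_\lambda$ exist and are unique. Moreover, fix $\alpha\in\mathcal A_s$ and a finite grid $\xi_1,\dots,\xi_n\in\mathcal X$, and let $\theta=[D^\alpha h_\lambda(\xi_j)]_{j=1}^n$, $\hat\theta=[D^\alpha\hat h_\lambda(\xi_j)]_{j=1}^n$ and $u_j=\Sigma_\lambda^{-1}\phi^{(\alpha)}(\xi_j)$. Then the matrix $\Omega_\lambda$ with entries $[\Omega_\lambda]_{kj}=\langle u_k,Q_\lambda u_j\rangle$ is positive semidefinite, and $$\sqrt N\,(\hat\theta-\theta)\ \xrightarrow{\ d\ }\ \mathcal N_n(0,\Omega_\lambda)\qquad(N\to\infty).$$ -/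

import Mathlib

open MeasureTheory ProbabilityTheory Filter Topology InnerProductSpace

namespace MeanVar

noncomputable section

/-! ### Functions on a subset of a Euclidean space, and their derivatives up to the boundary -/

/-- Extension by zero to the whole space of a real function given on a subset. Only its values near
interior points of the subset are ever differentiated. -/
def zeroExt {E : Type*} {S : Set E} (f : S → ℝ) : E → ℝ :=
  Function.extend Subtype.val f 0

/-- The class `C^m(S)`: `f` is continuous on `S`, it is `m` times continuously differentiable in the
interior of `S`, and its derivatives of order `k ≤ m` extend continuously from the interior to `S`.
For open `S` this is the usual class `C^m`. -/
def IsCk {E : Type*} [NormedAddCommGroup E] [NormedSpace ℝ E] (m : ℕ) {S : Set E}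
    (f : S → ℝ) : Prop :=
  Continuous f ∧ ContDiffOn ℝ m (zeroExt f) (interior S) ∧
    ∀ k : ℕ, k ≤ m → ∃ G : E → E [×k]→L[ℝ] ℝ,
      ContinuousOn G S ∧ Set.EqOn G (iteratedFDeriv ℝ k (zeroExt f)) (interior S)

/-- The partial derivative `∂f/∂x_i`. -/
def partialDeriv {d : ℕ} (i : Fin d) (f : EuclideanSpace ℝ (Fin d) → ℝ) :
    EuclideanSpace ℝ (Fin d) → ℝ :=
  fun x => lineDeriv ℝ f x (EuclideanSpace.single i 1)

/-- `∂^|α| f / ∂x_1^{α_1} ⋯ ∂x_d^{α_d}` for a function on the whole space. -/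
def multiDeriv {d : ℕ} (α : Fin d → ℕ) (f : EuclideanSpace ℝ (Fin d) → ℝ) :
    EuclideanSpace ℝ (Fin d) → ℝ :=
  (List.finRange d).foldr (fun i g => (partialDeriv i)^[α i] g) f

/-- `D^α f (x)` for a function `f` on `X` and a point `x` of `X`: the limit at `x` of the classical
partial derivative taken in the interior of `X`. For `f ∈ C^m(X)` and `|α| ≤ m`, this is the
classical partial derivative at interior points, and its continuous extension elsewhere. -/
def D {d : ℕ} {X : Set (EuclideanSpace ℝ (Fin d))} (α : Fin d → ℕ) (f : X → ℝ) (x : X) : ℝ :=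
  limUnder (𝓝[interior X] (x : EuclideanSpace ℝ (Fin d))) (multiDeriv α (zeroExt f))

/-- The multi-indices of order at most `s`. -/
def multiIdx (d s : ℕ) : Finset (Fin d → ℕ) :=
  (Fintype.piFinset fun _ => Finset.range (s + 1)).filter fun α => ∑ i, α i ≤ s

/-- A minimizer of `J` (if there is one). -/
def argmin {H : Type*} [Nonempty H] (J : H → ℝ) : H :=
  Classical.epsilon fun h => ∀ g, J h ≤ J g

/-! ### The kernel, and derivatives of the feature map -/

section Model

variable {d : ℕ} {X : Set (EuclideanSpace ℝ (Fin d))} {Y : Set ℝ}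
  (H : Type*) [NormedAddCommGroup H] [InnerProductSpace ℝ H] [CompleteSpace H] [RKHS ℝ H X ℝ]

/-- The reproducing kernel `K(x, y)` of `H`. -/
def kern (x y : X) : ℝ := RKHS.kernel H x y 1

/-- The reproducing kernel as a function on the subset `X × X` of the product space. -/
def kernProd (p : (X ×ˢ X : Set (EuclideanSpace ℝ (Fin d) × EuclideanSpace ℝ (Fin d)))) : ℝ :=
  kern H ⟨p.1.1, p.2.1⟩ ⟨p.1.2, p.2.2⟩

/-- `φ^(α)(x) = D^α K(x, ·)`, the element of `H` whose value at `y` is the `α`-derivative at `x`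
of `K(·, y)`. -/
def featDeriv (α : Fin d → ℕ) (x : X) : H :=
  Classical.epsilon fun g : H => ∀ y : X, g y = D α (fun x' => kern H x' y) x

/-- `ψ(z) = ∑_{|α| ≤ s} w_α(z) φ^(α)(x)` for `z = (x, y)`. -/
def psi (s : ℕ) (w : (Fin d → ℕ) → X × Y → ℝ) (z : X × Y) : H :=
  ∑ α ∈ multiIdx d s, w α z • featDeriv H α z.1

variable {H}

/-- The target functional `R(h; z) = ∑_{|α| ≤ s} w_α(z) D^α h(x)` for `z = (x, y)`. -/
def target (s : ℕ) (w : (Fin d → ℕ) → X × Y → ℝ) (h : H) (z : X × Y) : ℝ :=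
  ∑ α ∈ multiIdx d s, w α z * D α (fun x => h x) z.1

/-! ### The population and the empirical problem -/

/-- `J_λ(h) = - E[R(h; z)] + V[R(h; z)] / 2 + λ ‖h‖² / 2`, with `z ∼ P`. -/
def popObjective (s : ℕ) (w : (Fin d → ℕ) → X × Y → ℝ) (P : Measure (X × Y)) (lam : ℝ)
    (h : H) : ℝ :=
  -(∫ z, target s w h z ∂P) + 1 / 2 * Var[target s w h; P] + lam / 2 * ‖h‖ ^ 2

/-- The mean of a finite sample `r 0, …, r (N - 1)`. -/
def sampleMean (N : ℕ) (r : ℕ → ℝ) : ℝ := (N : ℝ)⁻¹ * ∑ i ∈ Finset.range N, r i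

/-- The variance of the empirical distribution of `r 0, …, r (N - 1)`. -/
def sampleVar (N : ℕ) (r : ℕ → ℝ) : ℝ := sampleMean N fun i => (r i - sampleMean N r) ^ 2

/-- The objective `J_λ` with `P` replaced by the empirical distribution of `z 0, …, z (N - 1)`. -/
def empObjective (s : ℕ) (w : (Fin d → ℕ) → X × Y → ℝ) (N : ℕ) (z : ℕ → X × Y) (lam : ℝ)
    (h : H) : ℝ :=
  -sampleMean N (fun i => target s w h (z i))
    + 1 / 2 * sampleVar N (fun i => target s w h (z i)) + lam / 2 * ‖h‖ ^ 2

variable (H)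

/-- `h_λ = argmin J_λ`. -/
def hPop (s : ℕ) (w : (Fin d → ℕ) → X × Y → ℝ) (P : Measure (X × Y)) (lam : ℝ) : H :=
  argmin (popObjective s w P lam)

/-- `ĥ_λ`, the minimizer of the empirical objective. -/
def hEmp (s : ℕ) (w : (Fin d → ℕ) → X × Y → ℝ) (N : ℕ) (z : ℕ → X × Y) (lam : ℝ) : H :=
  argmin (empObjective s w N z lam)

/-! ### Moments and the asymptotic covariance -/

/-- `μ = E[ψ]`. -/
def meanPsi (s : ℕ) (w : (Fin d → ℕ) → X × Y → ℝ) (P : Measure (X × Y)) : H :=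
  ∫ z, psi H s w z ∂P

/-- `Σ = E[(ψ - μ) ⊗ (ψ - μ)]`, where `(f ⊗ g) u = ⟪u, g⟫ f`. -/
def covPsi (s : ℕ) (w : (Fin d → ℕ) → X × Y → ℝ) (P : Measure (X × Y)) : H →L[ℝ] H :=
  ∫ z, rankOne ℝ (psi H s w z - meanPsi H s w P) (psi H s w z - meanPsi H s w P) ∂P

/-- `Σ_λ = Σ + λ I`. -/
def covReg (s : ℕ) (w : (Fin d → ℕ) → X × Y → ℝ) (P : Measure (X × Y)) (lam : ℝ) : H →L[ℝ] H :=
  covPsi H s w P + lam • (1 : H →L[ℝ] H)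

/-- `F(z) = (ψ(z) - μ) - ((ψ(z) - μ) ⊗ (ψ(z) - μ) - Σ) h_λ`. -/
def influence (s : ℕ) (w : (Fin d → ℕ) → X × Y → ℝ) (P : Measure (X × Y)) (lam : ℝ)
    (z : X × Y) : H :=
  (psi H s w z - meanPsi H s w P)
    - (rankOne ℝ (psi H s w z - meanPsi H s w P) (psi H s w z - meanPsi H s w P)
        - covPsi H s w P) (hPop H s w P lam)

/-- `Q_λ = E[F ⊗ F]`. -/
def Q (s : ℕ) (w : (Fin d → ℕ) → X × Y → ℝ) (P : Measure (X × Y)) (lam : ℝ) : H →L[ℝ] H :=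
  ∫ z, rankOne ℝ (influence H s w P lam z) (influence H s w P lam z) ∂P

/-- `u_j = Σ_λ⁻¹ φ^(α)(ξ_j)`. -/
def uVec (s : ℕ) (w : (Fin d → ℕ) → X × Y → ℝ) (P : Measure (X × Y)) (lam : ℝ)
    (α : Fin d → ℕ) {n : ℕ} (ξ : Fin n → X) (j : Fin n) : H :=
  Ring.inverse (covReg H s w P lam) (featDeriv H α (ξ j))

/-- The matrix `Ω_λ` with entries `⟪u_k, Q_λ u_j⟫`. -/
def omegaMat (s : ℕ) (w : (Fin d → ℕ) → X × Y → ℝ) (P : Measure (X × Y)) (lam : ℝ)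
    (α : Fin d → ℕ) {n : ℕ} (ξ : Fin n → X) : Matrix (Fin n) (Fin n) ℝ :=
  Matrix.of fun k j =>
    inner ℝ (uVec H s w P lam α ξ k) (Q H s w P lam (uVec H s w P lam α ξ j))

variable {H}

/-- The vector of the derivatives `D^α h(ξ_1), …, D^α h(ξ_n)` on the grid. -/
def gridEval (α : Fin d → ℕ) {n : ℕ} (ξ : Fin n → X) (h : H) : EuclideanSpace ℝ (Fin n) :=
  WithLp.toLp 2 fun j => D α (fun x => h x) (ξ j)

end Model

end

end MeanVar

/-!
Let `φ x = K(x, ·)` be the feature map. Since `⟪φ x, φ y⟫ = K(x, y)`, squared norms of increments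
and of difference quotients of `φ` are mixed differences of `K`, so that each derivative of `φ` uses
up one derivative of `K` in each variable: `K ∈ C^{2s}` makes `φ` of class `C^s` up to the boundary,
and pairing its derivatives with `h` differentiates `h`.

The reproducing property then turns the population and the empirical problem into Tikhonov problems
`-⟪h, m⟫ + ½⟪h, S h⟫ + (λ/2)‖h‖²` with solution `(S + λ)⁻¹ m`. If `h_λ = (Σ + λ)⁻¹ μ` and
`ĥ_λ = (Σ̂ + λ)⁻¹ μ̂`, then `ĥ_λ - h_λ = (Σ̂ + λ)⁻¹ ((μ̂ - μ) - (Σ̂ - Σ) h_λ)`, where the bracket is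
the empirical mean of `F` up to a product of two sampling errors. By the strong law `Σ̂ → Σ` and
`μ̂ → μ` almost surely, so replacing `Σ̂` by `Σ` and dropping the product changes `√N (ĥ_λ - h_λ)`
by `o_P(1)`, and the central limit theorem along each direction (Cramér–Wold) gives the Gaussian
limit.
-/

open Asymptotics

namespace MeanVar

/-! ### Functions whose derivatives extend continuously to a larger set -/

section CkUpTo

variable {E F G : Type*} [NormedAddCommGroup E] [NormedSpace ℝ E] [NormedAddCommGroup F]
  [NormedSpace ℝ F] [NormedAddCommGroup G] [NormedSpace ℝ G]

/-- The class of the functions that are `C^k` on `U` and whose derivatives of order at most `k`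
have limits, within `U`, at all points of `X`: the analogue of `IsCk` for vector-valued functions,
with extensions replaced by limits. -/
def CkUpTo (k : ℕ) (U X : Set E) (f : E → F) : Prop :=
  ContDiffOn ℝ k f U ∧
    ∀ j ≤ k, ∀ x ∈ X, ∃ l, Tendsto (iteratedFDeriv ℝ j f) (𝓝[U] x) (𝓝 l)

variable {k : ℕ} {U X : Set E} {f g : E → F}

lemma CkUpTo.exists_tendsto (hf : CkUpTo k U X f) {x : E} (hx : x ∈ X) :
    ∃ l, Tendsto f (𝓝[U] x) (𝓝 l) := by
  obtain ⟨l, hl⟩ := hf.2 0 k.zero_le x hx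
  refine ⟨continuousMultilinearCurryFin0 ℝ E F l, ?_⟩
  refine (((continuousMultilinearCurryFin0 ℝ E F).continuous.tendsto l).comp hl).congr fun y => ?_
  simp

lemma CkUpTo.zero (hf : ContinuousOn f U) (h : ∀ x ∈ X, ∃ l, Tendsto f (𝓝[U] x) (𝓝 l)) :
    CkUpTo 0 U X f := by
  refine ⟨by exact_mod_cast contDiffOn_zero.2 hf, fun j hj x hx => ?_⟩
  obtain rfl : j = 0 := by omega
  obtain ⟨l, hl⟩ := h x hx
  refine ⟨(continuousMultilinearCurryFin0 ℝ E F).symm l, ?_⟩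
  rw [iteratedFDeriv_zero_eq_comp]
  exact ((continuousMultilinearCurryFin0 ℝ E F).symm.continuous.tendsto l).comp hl

lemma CkUpTo.of_le (hf : CkUpTo k U X f) {j : ℕ} (hj : j ≤ k) : CkUpTo j U X f :=
  ⟨hf.1.of_le (by exact_mod_cast hj), fun i hi => hf.2 i (hi.trans hj)⟩

lemma CkUpTo.differentiableOn (hf : CkUpTo (k + 1) U X f) : DifferentiableOn ℝ f U :=
  hf.1.differentiableOn (by simp)

lemma CkUpTo.contDiffAt (hU : IsOpen U) (hf : CkUpTo k U X f) {j : ℕ} (hj : j ≤ k) {x : E}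
    (hx : x ∈ U) : ContDiffAt ℝ j f x :=
  (hf.1.contDiffAt (hU.mem_nhds hx)).of_le (by exact_mod_cast hj)

lemma CkUpTo.congr (hU : IsOpen U) (hf : CkUpTo k U X f) (h : Set.EqOn g f U) :
    CkUpTo k U X g := by
  refine ⟨hf.1.congr h, fun j hj x hx => ?_⟩
  obtain ⟨l, hl⟩ := hf.2 j hj x hx
  refine ⟨l, hl.congr' ?_⟩
  filter_upwards [self_mem_nhdsWithin] with y hy
  exact ((h.eventuallyEq_of_mem (hU.mem_nhds hy)).iteratedFDeriv ℝ j).eq_of_nhds.symm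

lemma CkUpTo.clm_comp (hU : IsOpen U) (hf : CkUpTo k U X f) (T : F →L[ℝ] G) :
    CkUpTo k U X (fun x => T (f x)) := by
  refine ⟨T.contDiff.comp_contDiffOn hf.1, fun j hj x hx => ?_⟩
  obtain ⟨l, hl⟩ := hf.2 j hj x hx
  have hT := (ContinuousLinearMap.compContinuousMultilinearMapL ℝ (fun _ : Fin j => E) F G
    T).continuous
  refine ⟨T.compContinuousMultilinearMap l, ((hT.tendsto l).comp hl).congr' ?_⟩
  filter_upwards [self_mem_nhdsWithin] with y hy
  exact (T.iteratedFDeriv_comp_left (hf.contDiffAt hU hj hy) le_rfl).symm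

lemma CkUpTo.sum (hU : IsOpen U) {ι : Type*} {I : Finset ι} {f : ι → E → F}
    (hf : ∀ i ∈ I, CkUpTo k U X (f i)) : CkUpTo k U X (fun x => ∑ i ∈ I, f i x) := by
  refine ⟨.sum fun i hi => (hf i hi).1, fun j hj x hx => ?_⟩
  choose! l hl using fun i hi => (hf i hi).2 j hj x hx
  refine ⟨∑ i ∈ I, l i, (tendsto_finsetSum I hl).congr' ?_⟩
  filter_upwards [self_mem_nhdsWithin] with y hy
  exact (iteratedFDeriv_fun_sum_apply fun i hi => (hf i hi).contDiffAt hU hj hy).symm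

lemma CkUpTo.fderiv_right (hU : IsOpen U) (hf : CkUpTo (k + 1) U X f) :
    CkUpTo k U X (fderiv ℝ f) := by
  refine ⟨((contDiffOn_succ_iff_fderiv_of_isOpen hU).1 (by exact_mod_cast hf.1)).2.2,
    fun j hj x hx => ?_⟩
  obtain ⟨l, hl⟩ := hf.2 (j + 1) (by omega) x hx
  let e := continuousMultilinearCurryRightEquiv' ℝ j E F
  refine ⟨e l, ((e.continuous.tendsto l).comp hl).congr fun y => ?_⟩
  rw [Function.comp_apply, iteratedFDeriv_succ_eq_comp_right, Function.comp_apply,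
    LinearIsometryEquiv.apply_symm_apply]

lemma CkUpTo.of_fderiv (hU : IsOpen U) (h0 : ∀ x ∈ X, ∃ l, Tendsto f (𝓝[U] x) (𝓝 l))
    (hd : DifferentiableOn ℝ f U) (hf : CkUpTo k U X (fderiv ℝ f)) : CkUpTo (k + 1) U X f := by
  refine ⟨?_, fun j hj x hx => ?_⟩
  · have : ContDiffOn ℝ ((k : WithTop ℕ∞) + 1) f U :=
      (contDiffOn_succ_iff_fderiv_of_isOpen hU).2 ⟨hd, by simp, hf.1⟩
    exact_mod_cast this
  · rcases j with _ | j
    · exact (CkUpTo.zero hd.continuousOn h0).2 0 le_rfl x hx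
    · obtain ⟨l, hl⟩ := hf.2 j (by omega) x hx
      let e := (continuousMultilinearCurryRightEquiv' ℝ j E F).symm
      refine ⟨e l, ((e.continuous.tendsto l).comp hl).congr fun y => ?_⟩
      rw [iteratedFDeriv_succ_eq_comp_right]

lemma CkUpTo.of_clm_apply [FiniteDimensional ℝ E] {U X : Set G} (hU : IsOpen U)
    {L : G → E →L[ℝ] F}
    (h : ∀ v, CkUpTo k U X (fun x => L x v)) : CkUpTo k U X L := by
  let b := Module.finBasis ℝ E
  have L_eq_sum : L = fun x => ∑ i, ContinuousLinearMap.smulRightL ℝ E F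
      (LinearMap.toContinuousLinearMap (b.coord i)) (L x (b i)) := by
    ext x v
    conv_lhs => rw [← b.sum_repr v, map_sum]
    simp
  rw [L_eq_sum]
  exact CkUpTo.sum hU fun i _ => (h (b i)).clm_comp hU _

end CkUpTo

/-! ### Regularity of a map into a Hilbert space from regularity of its Gram kernel -/

section MixedDerivative

variable {E F G : Type*} [NormedAddCommGroup E] [NormedSpace ℝ E] [NormedAddCommGroup F]
  [NormedSpace ℝ F] [NormedAddCommGroup G] [NormedSpace ℝ G]

/-- The mixed second derivative `∂₁∂₂κ` at `p` of a function of two variables, as a bilinear map: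
the block of the second Fréchet derivative that pairs the two factors. -/
noncomputable def mixedFDeriv (κ : E × F → G) (p : E × F) : E →L[ℝ] F →L[ℝ] G :=
  ((fderiv ℝ (fderiv ℝ κ) p).bilinearComp (.inr ℝ E F) (.inl ℝ E F)).flip

/-- The difference of the values of `κ` at the four corners of the rectangle with opposite corners
`(x, y)` and `(x + v, y + w)`. -/
def mixedDiff (κ : E × F → G) (x : E) (y : F) (v : E) (w : F) : G :=
  κ (x + v, y + w) - κ (x + v, y) - (κ (x, y + w) - κ (x, y))

lemma fderiv_sub_fderiv_sub_isLittleO {κ : E × F → G} {x : E} {y : F}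
    (hκ : ContDiffAt ℝ 2 κ (x, y)) :
    (fun q : E × F => fderiv ℝ κ (x + q.1, y + q.2) - fderiv ℝ κ (x + q.1, y)
      - fderiv ℝ (fderiv ℝ κ) (x, y) (0, q.2)) =o[𝓝 0] Prod.snd := by
  have hstrict : HasStrictFDerivAt (fderiv ℝ κ) (fderiv ℝ (fderiv ℝ κ) (x, y)) (x, y) :=
    (hκ.fderiv_right (m := 1) (by norm_num)).hasStrictFDerivAt (by norm_num)
  have hshift : Tendsto (fun q : E × F => ((x + q.1, y + q.2), (x + q.1, y))) (𝓝 0)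
      (𝓝 ((x, y), (x, y))) :=
    Continuous.tendsto' (by fun_prop) _ _ (by simp)
  refine ((hstrict.isLittleO.comp_tendsto hshift).congr_left fun q => ?_).trans_isBigO
    (.of_bound 1 (.of_forall fun q => ?_))
  · simp only [Function.comp_apply, Prod.mk_sub_mk, sub_self, add_sub_cancel_left]
  · simp

lemma mixedDiff_sub_isLittleO {κ : E × F → G} {x : E} {y : F} (hκ : ContDiffAt ℝ 2 κ (x, y)) :
    (fun q : E × F => mixedDiff κ x y q.1 q.2 - mixedFDeriv κ (x, y) q.1 q.2)
      =o[𝓝 0] fun q => ‖q.1‖ * ‖q.2‖ := by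
  refine isLittleO_iff.2 fun ε hε => ?_
  have hdiff : ∀ᶠ p in 𝓝 (x, y), DifferentiableAt ℝ κ p :=
    (hκ.eventually (by simp)).mono fun p hp => hp.differentiableAt (by simp)
  have hshift : Tendsto (fun q : E × F => (x + q.1, y + q.2)) (𝓝 0) (𝓝 (x, y)) :=
    Continuous.tendsto' (by fun_prop) _ _ (by simp)
  have hshift' : Tendsto (fun q : E × F => (x + q.1, y)) (𝓝 0) (𝓝 (x, y)) :=
    Continuous.tendsto' (by fun_prop) _ _ (by simp)
  obtain ⟨δ, hδ, hball⟩ := Metric.eventually_nhds_iff_ball.1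
    (((fderiv_sub_fderiv_sub_isLittleO hκ).def hε).and
      ((hshift.eventually hdiff).and (hshift'.eventually hdiff)))
  filter_upwards [Metric.ball_mem_nhds 0 hδ]
  rintro ⟨v, w⟩ hvw
  rw [← Prod.mk_zero_zero, ← ball_prod_same] at hvw hball
  let inl := ContinuousLinearMap.inl ℝ E F
  let D' : E → E × F →L[ℝ] G := fun u => fderiv ℝ κ (x + u, y + w) - fderiv ℝ κ (x + u, y)
    - fderiv ℝ (fderiv ℝ κ) (x, y) (0, w)
  have hderiv : ∀ u ∈ Metric.ball (0 : E) δ, HasFDerivWithinAt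
      (fun u => κ (x + u, y + w) - κ (x + u, y) - mixedFDeriv κ (x, y) u w)
      ((D' u).comp inl) (Metric.ball 0 δ) u := by
    intro u hu
    obtain ⟨-, hd, hd'⟩ := hball (u, w) ⟨hu, hvw.2⟩
    have hline (b : F) : HasFDerivAt (fun u : E => (x + u, b)) inl u :=
      ((hasFDerivAt_id u).const_add x).prodMk (hasFDerivAt_const b u)
    exact (((hd.hasFDerivAt.comp u (hline _)).sub (hd'.hasFDerivAt.comp u (hline _))).sub
      ((fderiv ℝ (fderiv ℝ κ) (x, y) (0, w)).comp inl).hasFDerivAt).hasFDerivWithinAt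
  have hbound : ∀ u ∈ Metric.ball (0 : E) δ, ‖(D' u).comp inl‖ ≤ ε * ‖w‖ := fun u hu =>
    calc ‖(D' u).comp inl‖ ≤ ‖D' u‖ * ‖inl‖ := ContinuousLinearMap.opNorm_comp_le _ _
      _ ≤ ‖D' u‖ := mul_le_of_le_one_right (norm_nonneg _)
          (ContinuousLinearMap.norm_inl_le_one ℝ E F)
      _ ≤ ε * ‖w‖ := (hball (u, w) ⟨hu, hvw.2⟩).1
  have hmvt := (convex_ball (0 : E) δ).norm_image_sub_le_of_norm_hasFDerivWithin_le hderiv hbound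
    (Metric.mem_ball_self hδ) hvw.1
  simpa [mixedDiff, mul_assoc, mul_comm, mul_left_comm, sub_right_comm] using hmvt

end MixedDerivative

section GramKernel

variable {E H : Type*} [NormedAddCommGroup H] [InnerProductSpace ℝ H]

/-- The Gram kernel `(x, y) ↦ ⟪f x, f y⟫` of a map `f` into a Hilbert space. -/
def gramKernel (f : E → H) (p : E × E) : ℝ := inner ℝ (f p.1) (f p.2)

lemma exists_tendsto_of_tendsto_gramKernel [CompleteSpace H] {l : Filter E} [l.NeBot] {f : E → H}
    {c : ℝ} (h : Tendsto (gramKernel f) (l ×ˢ l) (𝓝 c)) : ∃ L, Tendsto f l (𝓝 L) := by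
  refine cauchy_map_iff_exists_tendsto.1 (cauchy_map_iff.2 ⟨inferInstance, ?_⟩)
  rw [uniformity_eq_comap_nhds_zero, tendsto_comap_iff, tendsto_zero_iff_norm_tendsto_zero]
  have hfst : Tendsto (fun p : E × E => gramKernel f (p.1, p.1)) (l ×ˢ l) (𝓝 c) :=
    h.comp (tendsto_fst.prodMk tendsto_fst)
  have hsnd : Tendsto (fun p : E × E => gramKernel f (p.2, p.2)) (l ×ˢ l) (𝓝 c) :=
    h.comp (tendsto_snd.prodMk tendsto_snd)
  have hsq : Tendsto (fun p : E × E => ‖f p.2 - f p.1‖ ^ 2) (l ×ˢ l) (𝓝 0) := by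
    have := (hsnd.sub (h.const_mul 2)).add hfst
    rw [show c - 2 * c + c = 0 by ring] at this
    refine this.congr fun p => ?_
    simp only [gramKernel, real_inner_self_eq_norm_sq, norm_sub_sq_real,
      real_inner_comm (f p.1) (f p.2)]
  simpa [Real.sqrt_sq, Function.comp_def] using hsq.sqrt

section NormedSpace

variable [NormedAddCommGroup E] {f : E → H} {x y : E}

lemma mixedDiff_gramKernel (f : E → H) (x y v w : E) :
    mixedDiff (gramKernel f) x y v w = inner ℝ (f (x + v) - f x) (f (y + w) - f y) := by
  simp only [mixedDiff, gramKernel, inner_sub_left, inner_sub_right]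
  ring

variable [NormedSpace ℝ E]

lemma tendsto_inner_slope_mixedFDeriv (hf : ContDiffAt ℝ 2 (gramKernel f) (x, y)) (v w : E) :
    Tendsto (fun q : ℝ × ℝ => (inner ℝ (q.1⁻¹ • (f (x + q.1 • v) - f x))
        (q.2⁻¹ • (f (y + q.2 • w) - f y)) : ℝ)) (𝓝[≠] 0 ×ˢ 𝓝[≠] 0)
      (𝓝 (mixedFDeriv (gramKernel f) (x, y) v w)) := by
  have hscale : Tendsto (fun q : ℝ × ℝ => (q.1 • v, q.2 • w)) (𝓝[≠] 0 ×ˢ 𝓝[≠] 0) (𝓝 0) := by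
    rw [← nhdsWithin_prod_eq]
    exact tendsto_nhdsWithin_of_tendsto_nhds (Continuous.tendsto' (by fun_prop) _ _ (by simp))
  have hnorm : (fun q : ℝ × ℝ => ‖q.1 • v‖ * ‖q.2 • w‖)
      =O[𝓝[≠] 0 ×ˢ 𝓝[≠] 0] fun q => q.1 * q.2 :=
    .of_bound (‖v‖ * ‖w‖) (.of_forall fun q => by
      simp only [norm_smul, norm_mul, norm_norm]; exact le_of_eq (by ring))
  have hquot := (((mixedDiff_sub_isLittleO hf).comp_tendsto hscale).trans_isBigO
    hnorm).tendsto_div_nhds_zero.add_const (mixedFDeriv (gramKernel f) (x, y) v w)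
  rw [zero_add] at hquot
  refine hquot.congr' ?_
  filter_upwards [prod_mem_prod (self_mem_nhdsWithin (a := (0 : ℝ)))
    (self_mem_nhdsWithin (a := (0 : ℝ)))]
  rintro ⟨t, r⟩ ⟨ht : t ≠ 0, hr : r ≠ 0⟩
  simp only [Function.comp_apply, mixedDiff_gramKernel, map_smul, _root_.smul_apply, smul_eq_mul,
    real_inner_smul_left, real_inner_smul_right]
  field_simp
  ring

lemma exists_hasLineDerivAt_of_gramKernel [CompleteSpace H]
    (hf : ContDiffAt ℝ 2 (gramKernel f) (x, x)) (v : E) :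
    ∃ L, HasLineDerivAt ℝ f L x v := by
  obtain ⟨L, hL⟩ := exists_tendsto_of_tendsto_gramKernel
    (f := fun t : ℝ => t⁻¹ • (f (x + t • v) - f x)) (tendsto_inner_slope_mixedFDeriv hf v v)
  refine ⟨L, hasDerivAt_iff_tendsto_slope_zero.2 ?_⟩
  simpa using hL

lemma inner_eq_mixedFDeriv (hf : ContDiffAt ℝ 2 (gramKernel f) (x, y)) {v w : E} {L M : H}
    (hL : HasLineDerivAt ℝ f L x v) (hM : HasLineDerivAt ℝ f M y w) :
    inner ℝ L M = mixedFDeriv (gramKernel f) (x, y) v w := by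
  have hL' := hasDerivAt_iff_tendsto_slope_zero.1 hL
  have hM' := hasDerivAt_iff_tendsto_slope_zero.1 hM
  simp only [zero_add, zero_smul, add_zero] at hL' hM'
  exact tendsto_nhds_unique ((hL'.comp tendsto_fst).inner (hM'.comp tendsto_snd))
    (tendsto_inner_slope_mixedFDeriv hf v w)

lemma eventually_abs_inner_sub_sub_mixedFDeriv_le
    (hf : ContDiffAt ℝ 2 (gramKernel f) (x, y)) {ε : ℝ} (hε : 0 < ε) :
    ∀ᶠ v in 𝓝 0, ∀ w L, HasLineDerivAt ℝ f L y w →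
      |inner ℝ (f (x + v) - f x) L - mixedFDeriv (gramKernel f) (x, y) v w| ≤ ε * (‖v‖ * ‖w‖) := by
  have hmixed := (mixedDiff_sub_isLittleO hf).def hε
  rw [← Prod.mk_zero_zero, nhds_prod_eq] at hmixed
  filter_upwards [hmixed.curry] with v hv w L hL
  have hL' := (hasDerivAt_iff_tendsto_slope_zero.1 hL).mono_left (nhdsGT_le_nhdsNE 0)
  simp only [zero_add, zero_smul, add_zero] at hL'
  have hscale : Tendsto (fun r : ℝ => r • w) (𝓝[>] 0) (𝓝 0) :=
    tendsto_nhdsWithin_of_tendsto_nhds (Continuous.tendsto' (by fun_prop) _ _ (by simp))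
  refine le_of_tendsto ((tendsto_const_nhds.inner hL').sub_const _).abs ?_
  filter_upwards [hscale.eventually hv, self_mem_nhdsWithin] with r hr (hr0 : 0 < r)
  simp only [mixedDiff_gramKernel, map_smul, smul_eq_mul, Real.norm_eq_abs, norm_smul,
    abs_mul, abs_norm, abs_of_pos hr0] at hr
  have hfactor : inner ℝ (f (x + v) - f x) (r⁻¹ • (f (y + r • w) - f y))
      - mixedFDeriv (gramKernel f) (x, y) v w = r⁻¹ * (inner ℝ (f (x + v) - f x)
        (f (y + r • w) - f y) - r * mixedFDeriv (gramKernel f) (x, y) v w) := by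
    rw [real_inner_smul_right]
    field_simp
  rw [hfactor, abs_mul, abs_of_pos (inv_pos.2 hr0), inv_mul_le_iff₀ hr0]
  exact hr.trans_eq (by ring)

/-- Since `⟪L v, L w⟫ = ∂₁∂₂⟪f ·, f ·⟫ v w`, bilinearity of the right-hand side forces
`‖L (v + w) - L v - L w‖² = 0`, and its boundedness gives that of `L`. -/
lemma exists_clm_hasLineDerivAt_of_gramKernel [CompleteSpace H]
    (hf : ContDiffAt ℝ 2 (gramKernel f) (x, x)) :
    ∃ L : E →L[ℝ] H, ∀ v, HasLineDerivAt ℝ f (L v) x v := by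
  choose L hL using exists_hasLineDerivAt_of_gramKernel hf
  have hinner (v w : E) : inner ℝ (L v) (L w) = mixedFDeriv (gramKernel f) (x, x) v w :=
    inner_eq_mixedFDeriv hf (hL v) (hL w)
  have hadd (v w : E) : L (v + w) = L v + L w := by
    rw [← sub_eq_zero, ← inner_self_eq_zero (𝕜 := ℝ)]
    simp only [inner_sub_left, inner_sub_right, inner_add_left, inner_add_right, hinner, map_add,
      _root_.add_apply]
    ring
  have hsmul (c : ℝ) (v : E) : L (c • v) = c • L v := by
    rw [← (hL (c • v)).lineDeriv, ← (hL v).lineDeriv, lineDeriv_smul]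
  have hbound (v : E) : ‖L v‖ ≤ √‖mixedFDeriv (gramKernel f) (x, x)‖ * ‖v‖ := by
    refine le_of_sq_le_sq ?_ (by positivity)
    rw [mul_pow, Real.sq_sqrt (norm_nonneg (mixedFDeriv (gramKernel f) (x, x))),
      ← real_inner_self_eq_norm_sq, hinner, sq ‖v‖, ← mul_assoc]
    exact (le_abs_self _).trans ((mixedFDeriv (gramKernel f) (x, x)).le_opNorm₂ v v)
  exact ⟨LinearMap.mkContinuous ⟨⟨L, hadd⟩, hsmul⟩ _ hbound, hL⟩

/-- With `δ = f (x + v) - f x` and `B = ∂₁∂₂⟪f ·, f ·⟫`, each of `⟪δ, δ⟫`, `⟪δ, L v⟫` and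
`⟪L v, L v⟫` is `B v v + o(‖v‖²)`, so that `‖δ - L v‖² = o(‖v‖²)`. -/
theorem differentiableAt_of_gramKernel [CompleteSpace H]
    (hf : ContDiffAt ℝ 2 (gramKernel f) (x, x)) : DifferentiableAt ℝ f x := by
  obtain ⟨L, hL⟩ := exists_clm_hasLineDerivAt_of_gramKernel hf
  refine HasFDerivAt.differentiableAt (f' := L) ?_
  refine hasFDerivAt_iff_isLittleO_nhds_zero.2 (isLittleO_iff.2 fun c hc => ?_)
  have hε : 0 < c ^ 2 / 3 := by positivity
  have hdiag : Tendsto (fun v : E => (v, v)) (𝓝 0) (𝓝 0) :=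
    Continuous.tendsto' (by fun_prop) _ _ rfl
  filter_upwards [eventually_abs_inner_sub_sub_mixedFDeriv_le hf hε,
    hdiag.eventually ((mixedDiff_sub_isLittleO hf).def hε)] with v hcross hself
  have hcross := abs_le.1 (hcross v (L v) (hL v))
  have hlin := inner_eq_mixedFDeriv hf (hL v) (hL v)
  rw [mixedDiff_gramKernel, real_inner_self_eq_norm_sq, norm_mul, norm_norm,
    Real.norm_eq_abs] at hself
  rw [real_inner_self_eq_norm_sq] at hlin
  have hself := abs_le.1 hself
  refine le_of_sq_le_sq ?_ (by positivity)
  rw [norm_sub_sq_real, mul_pow]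
  linarith [hcross.1, hself.2]

lemma inner_fderiv_fderiv_eq_mixedFDeriv (hxy : ContDiffAt ℝ 2 (gramKernel f) (x, y))
    (hx : DifferentiableAt ℝ f x) (hy : DifferentiableAt ℝ f y) (v w : E) :
    inner ℝ (fderiv ℝ f x v) (fderiv ℝ f y w) = mixedFDeriv (gramKernel f) (x, y) v w :=
  inner_eq_mixedFDeriv hxy (hx.hasFDerivAt.hasLineDerivAt v) (hy.hasFDerivAt.hasLineDerivAt w)

lemma CkUpTo.zero_of_gramKernel [CompleteSpace H] {U X : Set E} (hU : IsOpen U) (hUX : U ⊆ X)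
    (hX : X ⊆ closure U) (hf : CkUpTo 0 (U ×ˢ U) (X ×ˢ X) (gramKernel f)) : CkUpTo 0 U X f := by
  have hlim : ∀ x ∈ X, ∃ l, Tendsto f (𝓝[U] x) (𝓝 l) := by
    intro x hx
    obtain ⟨c, hc⟩ := hf.exists_tendsto (x := (x, x)) ⟨hx, hx⟩
    rw [nhdsWithin_prod_eq] at hc
    have := mem_closure_iff_nhdsWithin_neBot.1 (hX hx)
    exact exists_tendsto_of_tendsto_gramKernel hc
  refine CkUpTo.zero (fun x hx => ?_) hlim
  obtain ⟨l, hl⟩ := hlim x (hUX hx)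
  rw [hU.nhdsWithin_eq hx] at hl
  exact (continuousAt_of_tendsto_nhds hl).continuousWithinAt

theorem CkUpTo.of_gramKernel [CompleteSpace H] [FiniteDimensional ℝ E] {U X : Set E}
    (hU : IsOpen U) (hUX : U ⊆ X) (hX : X ⊆ closure U) (s : ℕ)
    (hf : CkUpTo (2 * s) (U ×ˢ U) (X ×ˢ X) (gramKernel f)) : CkUpTo s U X f := by
  have hUU : IsOpen (U ×ˢ U) := hU.prod hU
  induction s generalizing f with
  | zero => exact CkUpTo.zero_of_gramKernel hU hUX hX hf
  | succ s ih =>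
    have hC2 {x y : E} (hx : x ∈ U) (hy : y ∈ U) : ContDiffAt ℝ 2 (gramKernel f) (x, y) :=
      hf.contDiffAt hUU (j := 2) (by omega) ⟨hx, hy⟩
    have hdiff {x : E} (hx : x ∈ U) := differentiableAt_of_gramKernel (hC2 hx hx)
    have hmixed : CkUpTo (2 * s) (U ×ˢ U) (X ×ˢ X) (fderiv ℝ (fderiv ℝ (gramKernel f))) :=
      ((hf.of_le (j := 2 * s + 2) (by omega)).fderiv_right hUU).fderiv_right hUU
    refine .of_fderiv hU (fun x hx => ((hf.of_le (by omega)).zero_of_gramKernel hU hUX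
      hX).exists_tendsto hx) (fun x hx => (hdiff hx).differentiableWithinAt)
      (.of_clm_apply hU fun v => ih ?_)
    refine ((hmixed.clm_comp hUU (.apply ℝ _ (0, v))).clm_comp hUU (.apply ℝ ℝ (v, 0))).congr hUU ?_
    exact fun p hp =>
      inner_fderiv_fderiv_eq_mixedFDeriv (hC2 hp.1 hp.2) (hdiff hp.1) (hdiff hp.2) v v

end NormedSpace

lemma continuous_of_continuous_gramKernel [TopologicalSpace E] [CompleteSpace H] {f : E → H}
    (h : Continuous (gramKernel f)) : Continuous f := by
  refine continuous_iff_continuousAt.2 fun x => ?_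
  have := h.tendsto (x, x)
  rw [nhds_prod_eq] at this
  obtain ⟨L, hL⟩ := exists_tendsto_of_tendsto_gramKernel this
  exact continuousAt_of_tendsto_nhds hL

end GramKernel

/-! ### Derivatives of the feature map and the derivative reproducing property -/

section ZeroExt

variable {E : Type*} {S : Set E}

lemma zeroExt_of_mem (f : S → ℝ) {x : E} (hx : x ∈ S) : zeroExt f x = f ⟨x, hx⟩ :=
  Subtype.val_injective.extend_apply f 0 ⟨x, hx⟩

lemma zeroExt_of_notMem (f : S → ℝ) {x : E} (hx : x ∉ S) : zeroExt f x = 0 :=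
  Function.extend_apply' _ _ _ (by rintro ⟨y, rfl⟩; exact hx y.2)

lemma IsCk.ckUpTo [NormedAddCommGroup E] [NormedSpace ℝ E] {m : ℕ} {f : S → ℝ} (hf : IsCk m f) :
    CkUpTo m (interior S) S (zeroExt f) := by
  refine ⟨hf.2.1, fun j hj x hx => ?_⟩
  obtain ⟨G, hG, hGe⟩ := hf.2.2 j hj
  refine ⟨G x, ((hG x hx).mono_left (nhdsWithin_mono x interior_subset)).congr' ?_⟩
  filter_upwards [self_mem_nhdsWithin] with y hy using hGe hy

lemma CkUpTo.isCk [NormedAddCommGroup E] [NormedSpace ℝ E] (hS : S ⊆ closure (interior S)) {m : ℕ}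
    {f : S → ℝ} (hc : Continuous f) (hf : CkUpTo m (interior S) S (zeroExt f)) : IsCk m f := by
  refine ⟨hc, hf.1, fun k hk => ⟨extendFrom (interior S) (iteratedFDeriv ℝ k (zeroExt f)),
    continuousOn_extendFrom hS (hf.2 k hk), fun x hx => ?_⟩⟩
  refine extendFrom_extends (fun y hy => ?_) x hx
  exact ((hf.contDiffAt isOpen_interior hk hy).continuousAt_iteratedFDeriv
    le_rfl).continuousWithinAt

end ZeroExt

section MultiDeriv

variable {d k : ℕ} {F : Type*} [NormedAddCommGroup F] [NormedSpace ℝ F]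
  {U X : Set (EuclideanSpace ℝ (Fin d))} {g : EuclideanSpace ℝ (Fin d) → F}

lemma eqOn_partialDeriv (hU : IsOpen U) (hg : DifferentiableOn ℝ g U) {T : F →L[ℝ] ℝ}
    {f : EuclideanSpace ℝ (Fin d) → ℝ} (hf : Set.EqOn f (fun x => T (g x)) U) (i : Fin d) :
    Set.EqOn (partialDeriv i f) (fun x => T (fderiv ℝ g x (EuclideanSpace.single i 1))) U := by
  intro x hx
  have hTg : HasFDerivAt (fun x => T (g x)) (T.comp (fderiv ℝ g x)) x :=
    T.hasFDerivAt.comp x (hg.differentiableAt (hU.mem_nhds hx)).hasFDerivAt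
  have hf' := hTg.congr_of_eventuallyEq (hf.eventuallyEq_of_mem (hU.mem_nhds hx))
  exact (hf'.hasLineDerivAt _).lineDeriv

lemma exists_eqOn_iterate_partialDeriv (hU : IsOpen U) (i : Fin d) (a : ℕ)
    (hg : CkUpTo (k + a) U X g) : ∃ g' : EuclideanSpace ℝ (Fin d) → F, CkUpTo k U X g' ∧
      ∀ (T : F →L[ℝ] ℝ) f, Set.EqOn f (fun x => T (g x)) U →
        Set.EqOn ((partialDeriv i)^[a] f) (fun x => T (g' x)) U := by
  induction a generalizing k with
  | zero => exact ⟨g, hg, fun _ _ hf => hf⟩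
  | succ a ih =>
    obtain ⟨g', hg', hT⟩ := ih (k := k + 1) (by rwa [add_right_comm, add_assoc])
    refine ⟨_, (hg'.fderiv_right hU).clm_comp hU (.apply ℝ F (EuclideanSpace.single i 1)),
      fun T f hf => ?_⟩
    rw [Function.iterate_succ_apply']
    exact eqOn_partialDeriv hU hg'.differentiableOn (hT T f hf) i

lemma exists_eqOn_foldr_partialDeriv (hU : IsOpen U) (β : Fin d → ℕ) (l : List (Fin d))
    (hg : CkUpTo (k + (l.map β).sum) U X g) :
    ∃ g' : EuclideanSpace ℝ (Fin d) → F, CkUpTo k U X g' ∧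
      ∀ (T : F →L[ℝ] ℝ) f, Set.EqOn f (fun x => T (g x)) U →
        Set.EqOn (l.foldr (fun i f => (partialDeriv i)^[β i] f) f) (fun x => T (g' x)) U := by
  induction l generalizing k with
  | nil => exact ⟨g, by simpa using hg, fun _ _ hf => hf⟩
  | cons i l ih =>
    obtain ⟨g', hg', hT⟩ := ih (k := k + β i) (by simpa [add_assoc] using hg)
    obtain ⟨g'', hg'', hT'⟩ := exists_eqOn_iterate_partialDeriv hU i (β i) hg'
    exact ⟨g'', hg'', fun T f hf => hT' T _ (hT T f hf)⟩

lemma exists_eqOn_multiDeriv (hU : IsOpen U) (β : Fin d → ℕ) (hg : CkUpTo (k + ∑ i, β i) U X g) :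
    ∃ g' : EuclideanSpace ℝ (Fin d) → F, CkUpTo k U X g' ∧
      ∀ (T : F →L[ℝ] ℝ) f, Set.EqOn f (fun x => T (g x)) U →
        Set.EqOn (multiDeriv β f) (fun x => T (g' x)) U :=
  exists_eqOn_foldr_partialDeriv hU β (List.finRange d) (Fin.sum_univ_def β ▸ hg)

end MultiDeriv

section FeatureMap

variable {d s : ℕ} {X : Set (EuclideanSpace ℝ (Fin d))} {H : Type*} [NormedAddCommGroup H]
  [InnerProductSpace ℝ H] [CompleteSpace H] [RKHS ℝ H X ℝ]

lemma inner_kerFun_one (h : H) (x : X) : inner ℝ h (RKHS.kerFun H x (1 : ℝ)) = h x := by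
  simp

lemma kern_eq_apply (x y : X) : kern H x y = RKHS.kerFun H y (1 : ℝ) x := by
  rw [kern, RKHS.kerFun_apply]

lemma kern_eq_inner (x y : X) :
    kern H x y = inner ℝ (RKHS.kerFun H x (1 : ℝ)) (RKHS.kerFun H y (1 : ℝ)) := by
  rw [real_inner_comm, inner_kerFun_one, kern_eq_apply]

variable (H X) in
/-- The feature map `x ↦ K(x, ·)`, extended by zero to the whole space, as `zeroExt` does for
real functions. -/
noncomputable def featExt : EuclideanSpace ℝ (Fin d) → H :=
  Function.extend Subtype.val (fun x : X => RKHS.kerFun H x (1 : ℝ)) 0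

lemma featExt_of_mem {x : EuclideanSpace ℝ (Fin d)} (hx : x ∈ X) :
    featExt X H x = RKHS.kerFun H ⟨x, hx⟩ (1 : ℝ) :=
  Subtype.val_injective.extend_apply (fun x : X => RKHS.kerFun H x (1 : ℝ)) 0 ⟨x, hx⟩

lemma featExt_of_notMem {x : EuclideanSpace ℝ (Fin d)} (hx : x ∉ X) : featExt X H x = 0 :=
  Function.extend_apply' _ _ _ (by rintro ⟨y, rfl⟩; exact hx y.2)

lemma zeroExt_eq_inner (h : H) (x : EuclideanSpace ℝ (Fin d)) :
    zeroExt (fun x : X => h x) x = inner ℝ h (featExt X H x) := by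
  by_cases hx : x ∈ X
  · rw [zeroExt_of_mem _ hx, featExt_of_mem hx, inner_kerFun_one]
  · rw [zeroExt_of_notMem _ hx, featExt_of_notMem hx, inner_zero_right]

lemma zeroExt_kernProd : zeroExt (kernProd (X := X) H) = gramKernel (featExt X H) := by
  ext p
  rw [gramKernel]
  by_cases hp : p ∈ X ×ˢ X
  · rw [zeroExt_of_mem _ hp, featExt_of_mem hp.1, featExt_of_mem hp.2, ← kern_eq_inner]
    rfl
  · rw [zeroExt_of_notMem _ hp]
    rcases not_and_or.1 hp with h | h
    · rw [featExt_of_notMem h, inner_zero_left]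
    · rw [featExt_of_notMem h, inner_zero_right]

lemma ckUpTo_featExt (hX : X ⊆ closure (interior X)) (hK : IsCk (2 * s) (kernProd (X := X) H)) :
    CkUpTo s (interior X) X (featExt X H) := by
  refine .of_gramKernel isOpen_interior interior_subset hX s ?_
  rw [← interior_prod_eq, ← zeroExt_kernProd]
  exact hK.ckUpTo

lemma continuous_kerFun_one (hK : Continuous (kernProd (X := X) H)) :
    Continuous fun x : X => RKHS.kerFun H x (1 : ℝ) := by
  have hK' : Continuous fun p : X × X => kernProd (X := X) H ⟨(p.1.1, p.2.1), p.1.2, p.2.2⟩ :=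
    hK.comp (by fun_prop)
  exact continuous_of_continuous_gramKernel (hK'.congr fun p => kern_eq_inner p.1 p.2)

theorem isCk_coe (hX : X ⊆ closure (interior X)) (hK : IsCk (2 * s) (kernProd (X := X) H)) (h : H) :
    IsCk s (fun x : X => h x) := by
  refine CkUpTo.isCk hX ?_ ?_
  · simpa only [inner_kerFun_one] using
      (continuous_const (y := h)).inner (𝕜 := ℝ) (continuous_kerFun_one hK.1)
  · exact ((ckUpTo_featExt hX hK).clm_comp isOpen_interior (innerSL ℝ h)).congr isOpen_interior
      fun x _ => zeroExt_eq_inner h x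

lemma exists_continuous_D_eq_inner (hX : X ⊆ closure (interior X))
    (hK : IsCk (2 * s) (kernProd (X := X) H)) {β : Fin d → ℕ} (hβ : β ∈ multiIdx d s) :
    ∃ G : X → H, Continuous G ∧ ∀ (h : H) (x : X), D β (fun x => h x) x = inner ℝ h (G x) := by
  have hβs : ∑ i, β i ≤ s := (Finset.mem_filter.1 hβ).2
  obtain ⟨g, hg, hgD⟩ := exists_eqOn_multiDeriv (k := 0) isOpen_interior β
    ((ckUpTo_featExt hX hK).of_le (by rwa [zero_add]))
  refine ⟨fun x => extendFrom (interior X) g x,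
    (continuousOn_extendFrom hX fun x hx => hg.exists_tendsto hx).domRestrict, fun h x => ?_⟩
  have hlim := tendsto_extendFrom (hg.exists_tendsto x.2)
  have := mem_closure_iff_nhdsWithin_neBot.1 (hX x.2)
  refine Tendsto.limUnder_eq ((((innerSL ℝ h).continuous.tendsto _).comp hlim).congr' ?_)
  filter_upwards [self_mem_nhdsWithin] with y hy
  exact (hgD (innerSL ℝ h) _ (fun x _ => zeroExt_eq_inner h x) hy).symm

theorem featDeriv_apply (hX : X ⊆ closure (interior X)) (hK : IsCk (2 * s) (kernProd (X := X) H))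
    {β : Fin d → ℕ} (hβ : β ∈ multiIdx d s) (x y : X) :
    featDeriv H β x y = D β (fun x' : X => kern H x' y) x := by
  obtain ⟨G, -, hG⟩ := exists_continuous_D_eq_inner hX hK hβ
  refine Classical.epsilon_spec (p := fun g : H => ∀ y : X, g y = D β (fun x' => kern H x' y) x)
    ⟨G x, fun y => ?_⟩ y
  simp only [kern_eq_apply]
  rw [hG, real_inner_comm, inner_kerFun_one]

lemma featDeriv_eq_of_D_eq_inner (hX : X ⊆ closure (interior X))
    (hK : IsCk (2 * s) (kernProd (X := X) H)) {β : Fin d → ℕ} (hβ : β ∈ multiIdx d s)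
    {G : X → H} (hG : ∀ (h : H) (x : X), D β (fun x => h x) x = inner ℝ h (G x)) :
    featDeriv H β = G := by
  ext x y
  rw [featDeriv_apply hX hK hβ]
  simp only [kern_eq_apply]
  rw [hG, real_inner_comm, inner_kerFun_one]

theorem D_eq_inner_featDeriv (hX : X ⊆ closure (interior X))
    (hK : IsCk (2 * s) (kernProd (X := X) H)) {β : Fin d → ℕ} (hβ : β ∈ multiIdx d s)
    (h : H) (x : X) : D β (fun x' : X => h x') x = inner ℝ h (featDeriv H β x) := by
  obtain ⟨G, -, hG⟩ := exists_continuous_D_eq_inner hX hK hβ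
  rw [hG, featDeriv_eq_of_D_eq_inner hX hK hβ hG]

theorem continuous_featDeriv (hX : X ⊆ closure (interior X))
    (hK : IsCk (2 * s) (kernProd (X := X) H)) {β : Fin d → ℕ} (hβ : β ∈ multiIdx d s) :
    Continuous (featDeriv H β : X → H) := by
  obtain ⟨G, hGc, hG⟩ := exists_continuous_D_eq_inner hX hK hβ
  rwa [featDeriv_eq_of_D_eq_inner hX hK hβ hG]

variable {Y : Set ℝ} {w : (Fin d → ℕ) → X × Y → ℝ}

theorem target_eq_inner (hX : X ⊆ closure (interior X)) (hK : IsCk (2 * s) (kernProd (X := X) H))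
    (h : H) (z : X × Y) : target s w h z = inner ℝ h (psi H s w z) := by
  rw [target, psi, inner_sum]
  refine Finset.sum_congr rfl fun β hβ => ?_
  rw [D_eq_inner_featDeriv hX hK hβ, real_inner_smul_right]

theorem stronglyMeasurable_psi (hX : X ⊆ closure (interior X))
    (hK : IsCk (2 * s) (kernProd (X := X) H)) (hw : ∀ β ∈ multiIdx d s, Measurable (w β)) :
    StronglyMeasurable (psi H s w : X × Y → H) :=
  Finset.stronglyMeasurable_fun_sum _ fun β hβ => (hw β hβ).stronglyMeasurable.smul
    ((continuous_featDeriv hX hK hβ).stronglyMeasurable.comp_measurable measurable_fst)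

end FeatureMap

/-! ### Tikhonov-regularized quadratic problems -/

section Tikhonov

variable {H : Type*} [NormedAddCommGroup H] [InnerProductSpace ℝ H] {S T : H →L[ℝ] H} {lam : ℝ}

lemma mul_norm_sq_le_inner_add_smul_one (hS : S.IsPositive) (lam : ℝ) (u : H) :
    lam * ‖u‖ ^ 2 ≤ inner ℝ u ((S + lam • (1 : H →L[ℝ] H)) u) := by
  have := hS.inner_nonneg_right u
  simp only [_root_.add_apply, _root_.smul_apply, one_apply_eq_self,
    inner_add_right, inner_smul_right, real_inner_self_eq_norm_sq]
  linarith

lemma norm_le_inv_mul_norm_add_smul_one_apply (hS : S.IsPositive) (hlam : 0 < lam) (u : H) :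
    ‖u‖ ≤ lam⁻¹ * ‖(S + lam • (1 : H →L[ℝ] H)) u‖ := by
  rcases eq_or_ne u 0 with rfl | hu
  · simp
  have hmul := (mul_norm_sq_le_inner_add_smul_one hS lam u).trans (real_inner_le_norm _ _)
  rw [← div_eq_inv_mul, le_div_iff₀ hlam]
  nlinarith [norm_pos_iff.2 hu]

variable [CompleteSpace H]

lemma isUnit_add_smul_one (hS : S.IsPositive) (hlam : 0 < lam) :
    IsUnit (S + lam • (1 : H →L[ℝ] H)) := by
  refine ContinuousLinearMap.isUnit_of_forall_le_norm_inner_map _ (c := ⟨lam, hlam.le⟩) hlam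
    fun u => ?_
  rw [real_inner_comm, mul_comm]
  exact (mul_norm_sq_le_inner_add_smul_one hS lam u).trans (le_abs_self _)

/-- The Tikhonov-regularized solution `(S + λ)⁻¹ m` of the equation `S h = m`. The inverse is
`Ring.inverse`, hence zero when `S + λ` is not invertible. -/
noncomputable def tikhonovSol (S : H →L[ℝ] H) (lam : ℝ) (m : H) : H :=
  Ring.inverse (S + lam • (1 : H →L[ℝ] H)) m

lemma add_smul_one_apply_tikhonovSol (hS : S.IsPositive) (hlam : 0 < lam) (m : H) :
    (S + lam • (1 : H →L[ℝ] H)) (tikhonovSol S lam m) = m := by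
  rw [tikhonovSol, ← mul_apply_eq_comp, Ring.mul_inverse_cancel _ (isUnit_add_smul_one hS hlam),
    one_apply_eq_self]

/-- The quadratic functional minimized by `tikhonovSol`. With `S` a covariance operator and `m` a
mean, it is the common form of the population and the empirical objective. -/
noncomputable def tikhonovObjective (S : H →L[ℝ] H) (lam : ℝ) (m h : H) : ℝ :=
  -inner ℝ h m + 1 / 2 * inner ℝ h (S h) + lam / 2 * ‖h‖ ^ 2

lemma tikhonovObjective_eq_add (hS : S.IsPositive) (hlam : 0 < lam) (m h : H) :
    tikhonovObjective S lam m h = tikhonovObjective S lam m (tikhonovSol S lam m) + 1 / 2 *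
      inner ℝ (h - tikhonovSol S lam m)
        ((S + lam • (1 : H →L[ℝ] H)) (h - tikhonovSol S lam m)) := by
  have hr := add_smul_one_apply_tikhonovSol hS hlam m
  set r := tikhonovSol S lam m
  have hsymm : (inner ℝ r (S h) : ℝ) = inner ℝ h (S r) := by
    rw [← hS.inner_left_eq_inner_right, real_inner_comm]
  rw [tikhonovObjective, tikhonovObjective, ← real_inner_self_eq_norm_sq,
    ← real_inner_self_eq_norm_sq, ← hr]
  simp only [map_sub, _root_.add_apply, _root_.smul_apply, one_apply_eq_self,
    inner_add_right, inner_smul_right, inner_sub_left, inner_sub_right, hsymm, real_inner_comm h r]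
  ring

theorem forall_tikhonovObjective_le_iff (hS : S.IsPositive) (hlam : 0 < lam) {m h : H} :
    (∀ g, tikhonovObjective S lam m h ≤ tikhonovObjective S lam m g) ↔
      h = tikhonovSol S lam m := by
  constructor
  · intro hmin
    have hle := hmin (tikhonovSol S lam m)
    rw [tikhonovObjective_eq_add hS hlam m h] at hle
    have hcoercive := mul_norm_sq_le_inner_add_smul_one hS lam (h - tikhonovSol S lam m)
    have hsq : ‖h - tikhonovSol S lam m‖ ^ 2 ≤ 0 :=
      nonpos_of_mul_nonpos_right (by linarith) hlam
    exact sub_eq_zero.1 (norm_eq_zero.1 (sq_nonpos_iff _ |>.1 hsq))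
  · rintro rfl g
    have hcoercive := mul_norm_sq_le_inner_add_smul_one hS lam (g - tikhonovSol S lam m)
    rw [tikhonovObjective_eq_add hS hlam m g]
    linarith [mul_nonneg hlam.le (sq_nonneg ‖g - tikhonovSol S lam m‖)]

theorem existsUnique_forall_tikhonovObjective_le (hS : S.IsPositive) (hlam : 0 < lam) (m : H) :
    ∃! h, ∀ g, tikhonovObjective S lam m h ≤ tikhonovObjective S lam m g := by
  simp only [forall_tikhonovObjective_le_iff hS hlam, existsUnique_eq]

theorem argmin_tikhonovObjective (hS : S.IsPositive) (hlam : 0 < lam) (m : H) :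
    argmin (tikhonovObjective S lam m) = tikhonovSol S lam m :=
  (forall_tikhonovObjective_le_iff hS hlam).1 <|
    Classical.epsilon_spec (existsUnique_forall_tikhonovObjective_le hS hlam m).exists

lemma add_smul_one_apply_tikhonovSol_sub (hS : S.IsPositive) (hT : T.IsPositive) (hlam : 0 < lam)
    (m m' : H) :
    (T + lam • (1 : H →L[ℝ] H)) (tikhonovSol T lam m' - tikhonovSol S lam m)
      = (m' - m) - (T - S) (tikhonovSol S lam m) := by
  have hS' := add_smul_one_apply_tikhonovSol hS hlam m
  rw [map_sub, add_smul_one_apply_tikhonovSol hT hlam]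
  simp only [_root_.add_apply, _root_.sub_apply] at hS' ⊢
  rw [eq_sub_of_add_eq' hS']
  abel

lemma norm_tikhonovSol_sub_le (hS : S.IsPositive) (hT : T.IsPositive) (hlam : 0 < lam)
    (m m' : H) :
    ‖tikhonovSol T lam m' - tikhonovSol S lam m‖
      ≤ lam⁻¹ * ‖(m' - m) - (T - S) (tikhonovSol S lam m)‖ := by
  rw [← add_smul_one_apply_tikhonovSol_sub hS hT hlam]
  exact norm_le_inv_mul_norm_add_smul_one_apply hT hlam _

lemma inner_tikhonovSol_sub (hS : S.IsPositive) (hT : T.IsPositive) (hlam : 0 < lam)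
    (m m' φ : H) :
    (inner ℝ (tikhonovSol T lam m' - tikhonovSol S lam m) φ : ℝ)
      = inner ℝ ((m' - m) - (T - S) (tikhonovSol S lam m)) (tikhonovSol S lam φ)
        - inner ℝ (tikhonovSol T lam m' - tikhonovSol S lam m) ((T - S) (tikhonovSol S lam φ)) := by
  rw [← add_smul_one_apply_tikhonovSol_sub hS hT hlam,
    (hT.add (ContinuousLinearMap.isPositive_one.smul_of_nonneg hlam.le)).inner_left_eq_inner_right,
    ← inner_sub_right]
  nth_rw 1 [← add_smul_one_apply_tikhonovSol hS hlam φ]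
  congr 1
  simp only [_root_.add_apply, _root_.sub_apply]
  abel

lemma abs_inner_tikhonovSol_sub_sub_le (hS : S.IsPositive) (hT : T.IsPositive) (hlam : 0 < lam)
    (m m' φ : H) :
    |inner ℝ (tikhonovSol T lam m' - tikhonovSol S lam m) φ
        - inner ℝ ((m' - m) - (T - S) (tikhonovSol S lam m)) (tikhonovSol S lam φ)|
      ≤ lam⁻¹ * ‖(m' - m) - (T - S) (tikhonovSol S lam m)‖
        * (‖T - S‖ * ‖tikhonovSol S lam φ‖) := by
  rw [inner_tikhonovSol_sub hS hT hlam, sub_sub_cancel_left, abs_neg]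
  refine (abs_real_inner_le_norm _ _).trans ?_
  gcongr
  · exact norm_tikhonovSol_sub_le hS hT hlam m m'
  · exact (T - S).le_opNorm _

end Tikhonov

/-! ### Empirical means and covariance operators -/

section Sample

/-- The mean of the sample `x 0, …, x (N - 1)`; it is `0` when `N = 0`. This is `sampleMean` for
vectors. -/
noncomputable def sampleAvg {E : Type*} [AddCommGroup E] [Module ℝ E] (N : ℕ) (x : ℕ → E) : E :=
  (N : ℝ)⁻¹ • ∑ i ∈ Finset.range N, x i

section Module

variable {E F : Type*} [AddCommGroup E] [Module ℝ E] [AddCommGroup F] [Module ℝ F]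

lemma map_sampleAvg {L : Type*} [FunLike L E F] [LinearMapClass L ℝ E F] (f : L) (N : ℕ)
    (x : ℕ → E) : f (sampleAvg N x) = sampleAvg N fun i => f (x i) := by
  simp only [sampleAvg, map_smul, map_sum]

lemma sampleAvg_sub (N : ℕ) (x y : ℕ → E) :
    sampleAvg N (fun i => x i - y i) = sampleAvg N x - sampleAvg N y := by
  simp only [sampleAvg, Finset.sum_sub_distrib, smul_sub]

lemma sampleAvg_const {N : ℕ} (hN : N ≠ 0) (m : E) : sampleAvg N (fun _ => m) = m := by
  simp [sampleAvg, ← Nat.cast_smul_eq_nsmul ℝ, hN]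

lemma sampleAvg_sub_const {N : ℕ} (hN : N ≠ 0) (x : ℕ → E) (m : E) :
    sampleAvg N (fun i => x i - m) = sampleAvg N x - m := by
  rw [sampleAvg_sub, sampleAvg_const hN]

end Module

variable {H : Type*} [NormedAddCommGroup H] [InnerProductSpace ℝ H]

lemma sampleAvg_apply (N : ℕ) (A : ℕ → H →L[ℝ] H) (u : H) :
    sampleAvg N A u = sampleAvg N fun i => A i u :=
  map_sampleAvg (ContinuousLinearMap.apply ℝ H u) N A

/-- The covariance operator of the empirical distribution of `x 0, …, x (N - 1)`. -/
noncomputable def sampleCov (N : ℕ) (x : ℕ → H) : H →L[ℝ] H :=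
  sampleAvg N fun i => rankOne ℝ (x i - sampleAvg N x) (x i - sampleAvg N x)

lemma inner_sampleAvg (N : ℕ) (x : ℕ → H) (h : H) :
    inner ℝ h (sampleAvg N x) = sampleMean N fun i => inner ℝ h (x i) :=
  map_sampleAvg (innerSL ℝ h) N x

lemma sampleCov_apply (N : ℕ) (x : ℕ → H) (u : H) :
    sampleCov N x u
      = sampleAvg N fun i => rankOne ℝ (x i - sampleAvg N x) (x i - sampleAvg N x) u :=
  sampleAvg_apply N _ u

lemma isPositive_sampleCov (N : ℕ) (x : ℕ → H) : (sampleCov N x).IsPositive :=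
  (ContinuousLinearMap.isPositive_sum _ fun _ _ => isPositive_rankOne_self _).smul_of_nonneg
    (by positivity)

lemma sampleVar_inner (N : ℕ) (x : ℕ → H) (h : H) :
    sampleVar N (fun i => inner ℝ h (x i)) = inner ℝ h (sampleCov N x h) := by
  simp only [sampleCov_apply, inner_sampleAvg, sampleVar, rankOne_apply, inner_smul_right,
    inner_sub_right, real_inner_comm h, sq]

lemma sampleCov_eq_sub_rankOne {N : ℕ} (hN : N ≠ 0) (x : ℕ → H) (m : H) :
    sampleCov N x = sampleAvg N (fun i => rankOne ℝ (x i - m) (x i - m))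
      - rankOne ℝ (sampleAvg N x - m) (sampleAvg N x - m) := by
  set δ := sampleAvg N x - m with hδ
  have hδ_avg : sampleAvg N (fun i => x i - m) = δ := sampleAvg_sub_const hN x m
  ext u
  have hexpand (i : ℕ) : rankOne ℝ (x i - sampleAvg N x) (x i - sampleAvg N x) u
      = rankOne ℝ (x i - m) (x i - m) u - rankOne ℝ δ u (x i - m)
        - (inner ℝ δ u • ((x i - m) - δ)) := by
    rw [show x i - sampleAvg N x = (x i - m) - δ by rw [hδ]; abel]
    simp only [rankOne_apply, inner_sub_left, real_inner_comm (x i - m) u]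
    module
  have hsmul : sampleAvg N (fun i => inner ℝ δ u • ((x i - m) - δ)) = 0 := by
    refine (map_sampleAvg (LinearMap.lsmul ℝ H (inner ℝ δ u)) N _).symm.trans ?_
    rw [sampleAvg_sub_const hN, hδ_avg, sub_self, map_zero]
  rw [sampleCov_apply, funext hexpand, sampleAvg_sub, sampleAvg_sub, hsmul, sub_zero,
    ← map_sampleAvg (rankOne ℝ δ u), hδ_avg, _root_.sub_apply, sampleAvg_apply, rankOne_apply,
    rankOne_apply, real_inner_comm]

/-- The influence function at `x` of the Tikhonov solution `h` for the mean `m` and the covariance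
operator `S`, before the inverse `(S + λ)⁻¹` is applied. -/
noncomputable def tikhonovInfluence (S : H →L[ℝ] H) (m h x : H) : H :=
  (x - m) - (rankOne ℝ (x - m) (x - m) - S) h

lemma sub_sampleCov_sub_apply {N : ℕ} (hN : N ≠ 0) (x : ℕ → H) (S : H →L[ℝ] H) (m h : H) :
    (sampleAvg N x - m) - (sampleCov N x - S) h
      = sampleAvg N (fun i => tikhonovInfluence S m h (x i))
        + inner ℝ (sampleAvg N x - m) h • (sampleAvg N x - m) := by
  have havg : sampleAvg N (fun i => tikhonovInfluence S m h (x i)) = (sampleAvg N x - m)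
      - (sampleAvg N (fun i => rankOne ℝ (x i - m) (x i - m)) - S) h := by
    simp only [tikhonovInfluence]
    rw [sampleAvg_sub, sampleAvg_sub_const hN, ← sampleAvg_apply, sampleAvg_sub_const hN]
  rw [havg, sampleCov_eq_sub_rankOne hN x m]
  simp only [_root_.sub_apply, rankOne_apply]
  abel

lemma abs_inner_tikhonovSol_sampleCov_sub_sub_le [CompleteSpace H] {S : H →L[ℝ] H} {lam : ℝ}
    (hS : S.IsPositive) (hlam : 0 < lam) (m φ : H) {N : ℕ} (hN : N ≠ 0) (x : ℕ → H) :
    |inner ℝ (tikhonovSol (sampleCov N x) lam (sampleAvg N x) - tikhonovSol S lam m) φ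
        - inner ℝ (sampleAvg N fun i => tikhonovInfluence S m (tikhonovSol S lam m) (x i))
          (tikhonovSol S lam φ)|
      ≤ (‖sampleAvg N x - m‖
          + ‖sampleAvg N fun i => tikhonovInfluence S m (tikhonovSol S lam m) (x i)‖)
        * (‖tikhonovSol S lam φ‖ * (‖sampleAvg N x - m‖ * ‖tikhonovSol S lam m‖
          + lam⁻¹ * (1 + ‖sampleAvg N x - m‖ * ‖tikhonovSol S lam m‖) * ‖sampleCov N x - S‖)) := by
  have hmain := abs_inner_tikhonovSol_sub_sub_le hS (isPositive_sampleCov N x) hlam m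
    (sampleAvg N x) φ
  rw [sub_sampleCov_sub_apply hN, inner_add_left, real_inner_smul_left] at hmain
  set u := tikhonovSol S lam φ
  set h := tikhonovSol S lam m
  set D := inner ℝ (tikhonovSol (sampleCov N x) lam (sampleAvg N x) - h) φ
  set δ := sampleAvg N x - m
  set a := sampleAvg N fun i => tikhonovInfluence S m h (x i)
  have hinner (v : H) : |inner ℝ δ v| ≤ ‖δ‖ * ‖v‖ := abs_real_inner_le_norm δ v
  have hresidual : ‖a + inner ℝ δ h • δ‖ ≤ ‖a‖ + ‖δ‖ * ‖h‖ * ‖δ‖ := by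
    refine (norm_add_le _ _).trans ?_
    rw [norm_smul, Real.norm_eq_abs]
    gcongr
    exact hinner h
  calc |D - inner ℝ a u|
      ≤ |D - (inner ℝ a u + inner ℝ δ h * inner ℝ δ u)| + |inner ℝ δ h| * |inner ℝ δ u| := by
        rw [← abs_mul]
        exact (congrArg _ (by ring)).trans_le (abs_add_le _ _)
    _ ≤ lam⁻¹ * (‖a‖ + ‖δ‖ * ‖h‖ * ‖δ‖) * (‖sampleCov N x - S‖ * ‖u‖)
          + ‖δ‖ * ‖h‖ * (‖δ‖ * ‖u‖) := by
        gcongr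
        · exact hmain.trans (by gcongr)
        · exact hinner h
        · exact hinner u
    _ ≤ (‖δ‖ + ‖a‖) * (‖u‖ * (‖δ‖ * ‖h‖ + lam⁻¹ * (1 + ‖δ‖ * ‖h‖) * ‖sampleCov N x - S‖)) := by
        have hdiff : 0 ≤ lam⁻¹ * ‖sampleCov N x - S‖ * ‖u‖ * (‖δ‖ + ‖a‖ * (‖δ‖ * ‖h‖))
            + ‖a‖ * (‖u‖ * (‖δ‖ * ‖h‖)) := by positivity
        linarith

end Sample

/-! ### Convergence in probability and in distribution -/

section Convergence

variable {Ω ι κ : Type*} [MeasurableSpace Ω] {μ : Measure Ω} [Fintype κ] {l : Filter ι}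

lemma tendstoInMeasure_zero_of_norm_le_mul [IsFiniteMeasure μ] {F : Type*} [NormedAddCommGroup F]
    {A B : ι → Ω → ℝ} {R : ι → Ω → F} {C : ℝ} (hA₀ : ∀ i ω, 0 ≤ A i ω)
    (hA : ∀ i, Integrable (A i) μ) (hAC : ∀ i, ∫ ω, A i ω ∂μ ≤ C) (hB₀ : ∀ i ω, 0 ≤ B i ω)
    (hB : TendstoInMeasure μ B l 0) (hR : ∀ᶠ i in l, ∀ ω, ‖R i ω‖ ≤ A i ω * B i ω) :
    TendstoInMeasure μ R l 0 := by
  rw [tendstoInMeasure_iff_measureReal_norm] at hB ⊢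
  intro ε hε
  simp only [Pi.zero_apply, sub_zero] at hB ⊢
  refine Metric.tendsto_nhds.2 fun η hη => ?_
  obtain ⟨M, hM, hMη⟩ : ∃ M > 0, C / M < η / 2 := by
    refine ⟨2 * (|C| + 1) / η, by positivity, ?_⟩
    rw [div_div_eq_mul_div, div_lt_iff₀ (by positivity)]
    nlinarith [le_abs_self C]
  filter_upwards [hR, (hB (ε / M) (by positivity)).eventually (gt_mem_nhds (half_pos hη))]
    with i hRi hBi
  have hcover : {ω | ε ≤ ‖R i ω‖} ⊆ {ω | M ≤ A i ω} ∪ {ω | ε / M ≤ ‖B i ω‖} := by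
    intro ω hω
    by_contra! hω'
    simp only [Set.mem_union, Set.mem_ofPred_eq, not_or, not_le, Real.norm_eq_abs,
      abs_of_nonneg (hB₀ i ω)] at hω hω'
    have hMB : M * B i ω < ε := by rw [mul_comm, ← lt_div_iff₀ hM]; exact hω'.2
    linarith [hRi ω, mul_le_mul_of_nonneg_right hω'.1.le (hB₀ i ω)]
  have hmarkov : μ.real {ω | M ≤ A i ω} ≤ C / M := by
    rw [le_div_iff₀ hM, mul_comm]
    exact (mul_meas_ge_le_integral_of_nonneg (ae_of_all _ (hA₀ i)) (hA i) M).trans (hAC i)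
  rw [Real.dist_eq, sub_zero, abs_of_nonneg measureReal_nonneg]
  linarith [(measureReal_mono hcover (measure_ne_top μ _)).trans (measureReal_union_le _ _)]

lemma tendstoInDistribution_multivariateGaussian_of_inner [IsProbabilityMeasure μ] [DecidableEq κ]
    {W : ℕ → Ω → EuclideanSpace ℝ κ} (hW : ∀ N, AEMeasurable (W N) μ) {C : Matrix κ κ ℝ}
    (hC : C.PosSemidef)
    (h : ∀ t : EuclideanSpace ℝ κ,
      TendstoInDistribution (fun N ω => (inner ℝ (W N ω) t : ℝ)) atTop id (fun _ => μ)
        (gaussianReal 0 (t.ofLp ⬝ᵥ C.mulVec t.ofLp).toNNReal)) :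
    TendstoInDistribution W atTop (id : EuclideanSpace ℝ κ → EuclideanSpace ℝ κ)
      (fun _ => μ) (multivariateGaussian 0 C) where
  forall_aemeasurable := hW
  aemeasurable_limit := aemeasurable_id
  tendsto := by
    refine ProbabilityMeasure.tendsto_iff_tendsto_charFun.2 fun t => ?_
    have hnonneg : 0 ≤ t.ofLp ⬝ᵥ C.mulVec t.ofLp := by
      simpa using hC.dotProduct_mulVec_nonneg t.ofLp
    have hchar := ProbabilityMeasure.tendsto_iff_tendsto_charFun.1 (h t).tendsto 1
    simp only [ProbabilityMeasure.coe_mk, Measure.map_id] at hchar ⊢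
    rw [charFun_gaussianReal, Real.coe_toNNReal _ hnonneg] at hchar
    rw [charFun_multivariateGaussian hC]
    convert hchar using 2 with N
    · rw [charFun_apply, charFun_apply, integral_map (hW N) (by fun_prop),
        integral_map ((h t).forall_aemeasurable N) (by fun_prop)]
      simp
    · simp

end Convergence

/-! ### Independent random elements of a Hilbert space -/

section Moments

variable {Ω : Type*} [MeasurableSpace Ω] {μ : Measure Ω} {H : Type*} [NormedAddCommGroup H]
  [InnerProductSpace ℝ H]

lemma integrable_inner_of_memLp_two {X Y : Ω → H} (hX : MemLp X 2 μ) (hY : MemLp Y 2 μ) :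
    Integrable (fun ω => (inner ℝ (X ω) (Y ω) : ℝ)) μ := by
  refine (hX.norm.integrable_mul hY.norm).mono (hX.1.inner hY.1) (ae_of_all _ fun ω => ?_)
  simpa using norm_inner_le_norm (𝕜 := ℝ) (X ω) (Y ω)

lemma integral_le_sqrt_integral_sq [IsProbabilityMeasure μ] {f : Ω → ℝ} (hf : MemLp f 2 μ) :
    ∫ ω, f ω ∂μ ≤ √(∫ ω, f ω ^ 2 ∂μ) := by
  refine Real.le_sqrt_of_sq_le (sub_nonneg.1 ?_)
  exact (variance_eq_sub hf) ▸ variance_nonneg f μ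

lemma memLp_sampleAvg {E : Type*} [NormedAddCommGroup E] [NormedSpace ℝ E] {Y : ℕ → Ω → E}
    {p : ENNReal} (hY : ∀ i, MemLp (Y i) p μ) (N : ℕ) :
    MemLp (fun ω => sampleAvg N fun i => Y i ω) p μ :=
  (memLp_finsetSum _ fun i _ => hY i).const_smul _

variable [CompleteSpace H] [MeasurableSpace H] [BorelSpace H] {Y : ℕ → Ω → H}

lemma integral_inner_eq_zero_of_indepFun [IsFiniteMeasure μ] {X Y : Ω → H} (hX : MemLp X 2 μ)
    (hY : MemLp Y 2 μ) (h : IndepFun X Y μ) (hX₀ : μ[X] = 0) :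
    ∫ ω, (inner ℝ (X ω) (Y ω) : ℝ) ∂μ = 0 := by
  have hbilin := h.integral_bilin (hX.integrable (by norm_num)) (hY.integrable (by norm_num))
    (innerSL ℝ)
  rwa [hX₀, map_zero, _root_.zero_apply] at hbilin

lemma integral_norm_sum_sq [IsFiniteMeasure μ] (hY : ∀ i, MemLp (Y i) 2 μ)
    (hind : Pairwise fun i j => IndepFun (Y i) (Y j) μ) (hY₀ : ∀ i, μ[Y i] = 0) (s : Finset ℕ) :
    ∫ ω, ‖∑ i ∈ s, Y i ω‖ ^ 2 ∂μ = ∑ i ∈ s, ∫ ω, ‖Y i ω‖ ^ 2 ∂μ := by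
  have hint (i j : ℕ) := integrable_inner_of_memLp_two (hY i) (hY j)
  simp only [← real_inner_self_eq_norm_sq, sum_inner, inner_sum]
  rw [integral_finsetSum _ fun i _ => integrable_finsetSum _ fun j _ => hint j i]
  refine Finset.sum_congr rfl fun i hi => ?_
  rw [integral_finsetSum _ fun j _ => hint j i]
  exact Finset.sum_eq_single_of_mem i hi fun j _ hji =>
    integral_inner_eq_zero_of_indepFun (hY j) (hY i) (hind hji) (hY₀ j)

variable [IsProbabilityMeasure μ]

lemma integral_sqrt_mul_norm_sampleAvg_le (hY : MemLp (Y 0) 2 μ)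
    (hid : ∀ i, IdentDistrib (Y i) (Y 0) μ μ) (hind : Pairwise fun i j => IndepFun (Y i) (Y j) μ)
    (hY₀ : μ[Y 0] = 0) (N : ℕ) :
    ∫ ω, √(N : ℝ) * ‖sampleAvg N fun i => Y i ω‖ ∂μ ≤ √(∫ ω, ‖Y 0 ω‖ ^ 2 ∂μ) := by
  have hYi (i : ℕ) : MemLp (Y i) 2 μ := (hid i).memLp_iff.2 hY
  have hsq (i : ℕ) : ∫ ω, ‖Y i ω‖ ^ 2 ∂μ = ∫ ω, ‖Y 0 ω‖ ^ 2 ∂μ :=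
    ((hid i).comp (u := fun v : H => ‖v‖ ^ 2)
      (by fun_prop : Continuous fun v : H => ‖v‖ ^ 2).measurable).integral_eq
  refine (integral_le_sqrt_integral_sq ((memLp_sampleAvg hYi N).norm.const_mul _)).trans ?_
  refine Real.sqrt_le_sqrt ?_
  have hN (ω : Ω) : (√(N : ℝ) * ‖sampleAvg N fun i => Y i ω‖) ^ 2
      = (N : ℝ)⁻¹ * ‖∑ i ∈ Finset.range N, Y i ω‖ ^ 2 := by
    rw [sampleAvg, norm_smul, mul_pow, mul_pow, Real.sq_sqrt N.cast_nonneg, norm_inv,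
      Real.norm_natCast]
    field_simp
  simp only [hN]
  rw [integral_const_mul, integral_norm_sum_sq hYi hind (fun i => (hid i).integral_eq.trans hY₀)]
  simp only [hsq, Finset.sum_const, Finset.card_range, nsmul_eq_mul, ← mul_assoc]
  exact mul_le_of_le_one_left (by positivity) inv_mul_le_one

lemma tendstoInDistribution_sqrt_mul_inner_sampleAvg (hY : MemLp (Y 0) 2 μ)
    (hid : ∀ i, IdentDistrib (Y i) (Y 0) μ μ) (hind : iIndepFun Y μ) (hY₀ : μ[Y 0] = 0) (u : H) :
    TendstoInDistribution
      (fun (N : ℕ) ω => √(N : ℝ) * inner ℝ (sampleAvg N fun i => Y i ω) u) atTop id (fun _ => μ)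
      (gaussianReal 0 (∫ ω, inner ℝ (Y 0 ω) u ^ 2 ∂μ).toNNReal) := by
  have hu : Measurable fun y : H => (inner ℝ y u : ℝ) := by fun_prop
  have hmean : ∫ ω, (inner ℝ (Y 0 ω) u : ℝ) ∂μ = 0 := by
    simp only [real_inner_comm u]
    rw [integral_inner (hY.integrable (by norm_num)), hY₀, inner_zero_right]
  have hvar : Var[fun ω => (inner ℝ (Y 0 ω) u : ℝ); μ] = ∫ ω, inner ℝ (Y 0 ω) u ^ 2 ∂μ :=
    variance_of_integral_eq_zero (hY.inner_const u).1.aemeasurable hmean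
  have hclt := tendstoInDistribution_inv_sqrt_mul_sum_sub (P := μ) (Y := id)
    (P' := gaussianReal 0 (∫ ω, inner ℝ (Y 0 ω) u ^ 2 ∂μ).toNNReal)
    (X := fun i ω => (inner ℝ (Y i ω) u : ℝ)) (by rw [hvar]; exact HasLaw.id) (hY.inner_const u)
    (hind.comp _ fun _ => hu) fun i => (hid i).comp hu
  convert hclt using 3 with N ω
  rw [hmean, mul_zero, sub_zero, sampleAvg, real_inner_smul_left, sum_inner, ← mul_assoc,
    ← div_eq_mul_inv, Real.sqrt_div_self]

end Moments

/-! ### Covariance operators -/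

section Covariance

variable {Ω : Type*} [MeasurableSpace Ω] {μ : Measure Ω} {H : Type*} [NormedAddCommGroup H]
  [InnerProductSpace ℝ H] {W : Ω → H}

lemma continuous_rankOne_self : Continuous fun x : H => (rankOne ℝ x x : H →L[ℝ] H) :=
  (rankOne ℝ (E := H) (F := H)).continuous₂.comp (continuous_id.prodMk continuous_id)

lemma integrable_rankOne_self (hW : MemLp W 2 μ) :
    Integrable (fun ω => (rankOne ℝ (W ω) (W ω) : H →L[ℝ] H)) μ := by
  refine (hW.integrable_norm_pow (p := 2) (by norm_num)).mono'
    (continuous_rankOne_self.comp_aestronglyMeasurable hW.1) (ae_of_all _ fun ω => ?_)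
  rw [norm_rankOne, sq]

/-- The covariance operator of the random element `W`. -/
noncomputable def covOp (W : Ω → H) (μ : Measure Ω) : H →L[ℝ] H :=
  ∫ ω, rankOne ℝ (W ω - μ[W]) (W ω - μ[W]) ∂μ

lemma memLp_comp_hasLaw {T E : Type*} [MeasurableSpace T] [NormedAddCommGroup E] {P : Measure T}
    {Z : Ω → T} {f : T → E} {p : ENNReal} (hZ : HasLaw Z P μ) (hf : MemLp f p P) :
    MemLp (fun ω => f (Z ω)) p μ := by
  rw [← hZ.map_eq] at hf
  exact (memLp_map_measure_iff hf.1 hZ.aemeasurable).1 hf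

lemma covOp_comp_hasLaw {T : Type*} [MeasurableSpace T] {P : Measure T} {Z : Ω → T} {f : T → H}
    (hZ : HasLaw Z P μ) (hf : AEStronglyMeasurable f P) :
    covOp (fun ω => f (Z ω)) μ = covOp f P := by
  rw [covOp, show ∫ ω, f (Z ω) ∂μ = ∫ z, f z ∂P from hZ.integral_comp hf]
  exact hZ.integral_comp (f := fun z => rankOne ℝ (f z - ∫ z, f z ∂P) (f z - ∫ z, f z ∂P))
    (continuous_rankOne_self.comp_aestronglyMeasurable (hf.sub aestronglyMeasurable_const))

variable [CompleteSpace H]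

lemma inner_integral_rankOne_self_apply (hW : MemLp W 2 μ) (u v : H) :
    (inner ℝ v ((∫ ω, (rankOne ℝ (W ω) (W ω) : H →L[ℝ] H) ∂μ) u) : ℝ)
      = ∫ ω, inner ℝ v (W ω) * inner ℝ u (W ω) ∂μ := by
  rw [ContinuousLinearMap.integral_apply (integrable_rankOne_self hW),
    ← integral_inner ((integrable_rankOne_self hW).apply_continuousLinearMap u)]
  simp only [rankOne_apply, inner_smul_right, real_inner_comm u, mul_comm]

lemma isPositive_integral_rankOne_self (hW : MemLp W 2 μ) :
    (∫ ω, (rankOne ℝ (W ω) (W ω) : H →L[ℝ] H) ∂μ).IsPositive := by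
  refine (ContinuousLinearMap.isPositive_iff _).2 ⟨fun u v => ?_, fun u => ?_⟩
  · rw [ContinuousLinearMap.coe_coe, real_inner_comm, inner_integral_rankOne_self_apply hW,
      inner_integral_rankOne_self_apply hW]
    simp only [mul_comm]
  · rw [real_inner_comm, inner_integral_rankOne_self_apply hW]
    exact integral_nonneg fun ω => mul_self_nonneg _

lemma isPositive_covOp [IsFiniteMeasure μ] (hW : MemLp W 2 μ) : (covOp W μ).IsPositive :=
  isPositive_integral_rankOne_self (hW.sub (memLp_const _))

lemma variance_inner [IsFiniteMeasure μ] (hW : MemLp W 2 μ) (h : H) :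
    Var[fun ω => (inner ℝ h (W ω) : ℝ); μ] = inner ℝ h (covOp W μ h) := by
  have hcentered : MemLp (fun ω => W ω - μ[W]) 2 μ := hW.sub (memLp_const _)
  rw [covOp, inner_integral_rankOne_self_apply hcentered,
    variance_eq_integral (hW.1.const_inner (𝕜 := ℝ)).aemeasurable,
    integral_inner (hW.integrable (by norm_num))]
  simp only [inner_sub_right, sq]

end Covariance

/-! ### Asymptotic normality of the empirical Tikhonov solution -/

section Measurability

variable {Ω : Type*} [MeasurableSpace Ω] {μ : Measure Ω} {H : Type*} [NormedAddCommGroup H]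
  [InnerProductSpace ℝ H] {V : ℕ → Ω → H}

lemma aestronglyMeasurable_comp_of_ae_continuousAt {A B : Type*} [TopologicalSpace A]
    [TopologicalSpace B] [TopologicalSpace.PseudoMetrizableSpace B] {f : Ω → A} {g : A → B}
    (hf : AEStronglyMeasurable f μ) (hg : ∀ᵐ ω ∂μ, ContinuousAt g (f ω)) :
    AEStronglyMeasurable (fun ω => g (f ω)) μ := by
  refine aestronglyMeasurable_of_tendsto_ae atTop
    (f := fun n ω => g (hf.stronglyMeasurable_mk.approx n ω))
    (fun n => ((hf.stronglyMeasurable_mk.approx n).map g).aestronglyMeasurable) ?_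
  filter_upwards [hf.ae_eq_mk, hg] with ω hω hgω
  have happrox := hf.stronglyMeasurable_mk.tendsto_approx ω
  rw [← hω] at happrox
  exact hgω.tendsto.comp happrox

lemma aestronglyMeasurable_sampleAvg {E : Type*} [NormedAddCommGroup E] [NormedSpace ℝ E]
    {Y : ℕ → Ω → E} (hY : ∀ i, AEStronglyMeasurable (Y i) μ) (N : ℕ) :
    AEStronglyMeasurable (fun ω => sampleAvg N fun i => Y i ω) μ :=
  (Finset.aestronglyMeasurable_fun_sum _ fun i _ => hY i).const_smul _

lemma aestronglyMeasurable_sampleCov (hV : ∀ i, AEStronglyMeasurable (V i) μ) (N : ℕ) :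
    AEStronglyMeasurable (fun ω => sampleCov N fun i => V i ω) μ :=
  aestronglyMeasurable_sampleAvg (fun i => continuous_rankOne_self.comp_aestronglyMeasurable
    ((hV i).sub (aestronglyMeasurable_sampleAvg hV N))) N

lemma aestronglyMeasurable_tikhonovSol_sampleCov [CompleteSpace H]
    (hV : ∀ i, AEStronglyMeasurable (V i) μ) {lam : ℝ} (hlam : 0 < lam) (N : ℕ) :
    AEStronglyMeasurable (fun ω =>
      tikhonovSol (sampleCov N fun i => V i ω) lam (sampleAvg N fun i => V i ω)) μ := by
  have hinv : AEStronglyMeasurable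
      (fun ω => Ring.inverse ((sampleCov N fun i => V i ω) + lam • (1 : H →L[ℝ] H))) μ := by
    refine aestronglyMeasurable_comp_of_ae_continuousAt (g := Ring.inverse)
      ((aestronglyMeasurable_sampleCov hV N).add aestronglyMeasurable_const)
      (ae_of_all _ fun ω => ?_)
    obtain ⟨a, ha⟩ := isUnit_add_smul_one (isPositive_sampleCov N fun i => V i ω) hlam
    exact ha ▸ NormedRing.inverse_continuousAt a
  exact isBoundedBilinearMap_apply.continuous.comp_aestronglyMeasurable
    (hinv.prodMk (aestronglyMeasurable_sampleAvg hV N))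

end Measurability

section Influence

variable {Ω : Type*} [MeasurableSpace Ω] {μ : Measure Ω} {H : Type*} [NormedAddCommGroup H]
  [InnerProductSpace ℝ H] {W : Ω → H}

lemma continuous_tikhonovInfluence (S : H →L[ℝ] H) (m h : H) :
    Continuous (tikhonovInfluence S m h) := by
  have hcentered : Continuous fun x : H => x - m := continuous_id.sub continuous_const
  exact hcentered.sub (((continuous_rankOne_self.comp hcentered).sub continuous_const).clm_apply
    continuous_const)

lemma memLp_rankOne_self_apply (hW : MemLp W 4 μ) (u : H) :
    MemLp (fun ω => rankOne ℝ (W ω) (W ω) u) 2 μ := by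
  have hmeas : AEStronglyMeasurable (fun ω => rankOne ℝ (W ω) (W ω) u) μ :=
    (continuous_rankOne_self.comp_aestronglyMeasurable hW.1).apply_continuousLinearMap u
  refine (memLp_two_iff_integrable_sq_norm hmeas).2 ?_
  refine ((hW.integrable_norm_pow (p := 4) (by norm_num)).mul_const (‖u‖ ^ 2)).mono'
    (hmeas.norm.pow 2) (ae_of_all _ fun ω => ?_)
  calc ‖‖rankOne ℝ (W ω) (W ω) u‖ ^ 2‖ = ‖rankOne ℝ (W ω) (W ω) u‖ ^ 2 := by simp
    _ ≤ (‖W ω‖ * ‖W ω‖ * ‖u‖) ^ 2 := by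
      gcongr
      exact (ContinuousLinearMap.le_opNorm _ u).trans_eq (by rw [norm_rankOne])
    _ = ‖W ω‖ ^ 4 * ‖u‖ ^ 2 := by ring

variable [IsProbabilityMeasure μ]

lemma memLp_tikhonovInfluence (hW : MemLp W 4 μ) (S : H →L[ℝ] H) (m h : H) :
    MemLp (fun ω => tikhonovInfluence S m h (W ω)) 2 μ := by
  have hcentered : MemLp (fun ω => W ω - m) 4 μ := hW.sub (memLp_const m)
  exact (hcentered.mono_exponent (by norm_num)).sub
    ((memLp_rankOne_self_apply hcentered h).sub (memLp_const _))

lemma integral_tikhonovInfluence_covOp [CompleteSpace H] (hW : MemLp W 2 μ) (h : H) :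
    ∫ ω, tikhonovInfluence (covOp W μ) μ[W] h (W ω) ∂μ = 0 := by
  have hW₁ : Integrable W μ := hW.integrable (by norm_num)
  have hcentered : MemLp (fun ω => W ω - μ[W]) 2 μ := hW.sub (memLp_const _)
  have hrank := integrable_rankOne_self hcentered
  have hrank_sub : Integrable (fun ω => rankOne ℝ (W ω - μ[W]) (W ω - μ[W]) - covOp W μ) μ :=
    hrank.sub (integrable_const _)
  have hrank_zero : ∫ ω, (rankOne ℝ (W ω - μ[W]) (W ω - μ[W]) - covOp W μ) ∂μ = 0 := by
    rw [integral_sub hrank (integrable_const _), integral_const, probReal_univ, one_smul]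
    exact sub_self _
  have hmean_zero : ∫ ω, (W ω - μ[W]) ∂μ = 0 := by
    rw [integral_sub hW₁ (integrable_const _), integral_const, probReal_univ, one_smul, sub_self]
  simp only [tikhonovInfluence]
  rw [integral_sub (hcentered.integrable (by norm_num)) (hrank_sub.apply_continuousLinearMap h),
    hmean_zero, ← ContinuousLinearMap.integral_apply hrank_sub, hrank_zero,
    _root_.zero_apply, sub_zero]

end Influence

section IID

variable {Ω : Type*} [MeasurableSpace Ω] {μ : Measure Ω} [IsProbabilityMeasure μ]
  {H : Type*} [NormedAddCommGroup H] [InnerProductSpace ℝ H] [CompleteSpace H]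
  [MeasurableSpace H] [BorelSpace H] {V : ℕ → Ω → H}

lemma ae_tendsto_sampleAvg (hV : MemLp (V 0) 2 μ) (hid : ∀ i, IdentDistrib (V i) (V 0) μ μ)
    (hind : Pairwise fun i j => IndepFun (V i) (V j) μ) :
    ∀ᵐ ω ∂μ, Tendsto (fun N => sampleAvg N fun i => V i ω) atTop (𝓝 μ[V 0]) :=
  strong_law_ae V (hV.integrable (by norm_num)) hind hid

lemma ae_tendsto_sampleCov (hV : MemLp (V 0) 2 μ) (hid : ∀ i, IdentDistrib (V i) (V 0) μ μ)
    (hind : Pairwise fun i j => IndepFun (V i) (V j) μ) :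
    ∀ᵐ ω ∂μ, Tendsto (fun N => sampleCov N fun i => V i ω) atTop (𝓝 (covOp (V 0) μ)) := by
  set m := μ[V 0]
  have hg : Continuous fun x : H => (rankOne ℝ (x - m) (x - m) : H →L[ℝ] H) :=
    continuous_rankOne_self.comp (continuous_id.sub continuous_const)
  have hrank : ∀ᵐ ω ∂μ, Tendsto (fun N => sampleAvg N fun i => rankOne ℝ (V i ω - m) (V i ω - m))
      atTop (𝓝 (covOp (V 0) μ)) :=
    strong_law_ae _ (integrable_rankOne_self (hV.sub (memLp_const m)))
      (fun _ _ hij => (hind hij).comp hg.measurable hg.measurable)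
      fun i => (hid i).comp hg.measurable
  filter_upwards [ae_tendsto_sampleAvg hV hid hind, hrank] with ω havg hrankω
  have hdiff := (hg.tendsto m).comp havg
  rw [sub_self, map_zero] at hdiff
  have hlim := hrankω.sub hdiff
  rw [sub_zero] at hlim
  refine hlim.congr' ?_
  filter_upwards [eventually_ne_atTop 0] with N hN
  exact (sampleCov_eq_sub_rankOne hN _ m).symm

lemma tendstoInMeasure_comp_sampleAvg_sampleCov (hV : MemLp (V 0) 2 μ)
    (hid : ∀ i, IdentDistrib (V i) (V 0) μ μ) (hind : Pairwise fun i j => IndepFun (V i) (V j) μ)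
    {f : H → (H →L[ℝ] H) → ℝ} (hf : Continuous f.uncurry) (hf₀ : f μ[V 0] (covOp (V 0) μ) = 0) :
    TendstoInMeasure μ
      (fun N ω => f (sampleAvg N fun i => V i ω) (sampleCov N fun i => V i ω)) atTop 0 := by
  have hVi (i : ℕ) : AEStronglyMeasurable (V i) μ := ((hid i).memLp_iff.2 hV).1
  refine tendstoInMeasure_of_tendsto_ae (fun N => hf.comp_aestronglyMeasurable
    ((aestronglyMeasurable_sampleAvg hVi N).prodMk (aestronglyMeasurable_sampleCov hVi N))) ?_
  filter_upwards [ae_tendsto_sampleAvg hV hid hind, ae_tendsto_sampleCov hV hid hind]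
    with ω havg hcov
  rw [Pi.zero_apply, ← hf₀]
  exact (hf.tendsto (_, _)).comp (havg.prodMk_nhds hcov)

variable {S : H →L[ℝ] H} {m : H} {lam : ℝ}

lemma exists_integral_sqrt_mul_norm_sampleAvg_comp_le (hid : ∀ i, IdentDistrib (V i) (V 0) μ μ)
    (hind : Pairwise fun i j => IndepFun (V i) (V j) μ) {g : H → H} (hg : Continuous g)
    (hg₂ : MemLp (fun ω => g (V 0 ω)) 2 μ) (hg₀ : ∫ ω, g (V 0 ω) ∂μ = 0) :
    (∀ N : ℕ, Integrable (fun ω => √(N : ℝ) * ‖sampleAvg N fun i => g (V i ω)‖) μ) ∧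
      ∃ C, ∀ N : ℕ, ∫ ω, √(N : ℝ) * ‖sampleAvg N fun i => g (V i ω)‖ ∂μ ≤ C := by
  have hid_g (i : ℕ) := (hid i).comp hg.measurable
  refine ⟨fun N => ?_, _, fun N => integral_sqrt_mul_norm_sampleAvg_le
    (Y := fun i ω => g (V i ω)) hg₂ hid_g
    (fun _ _ hij => (hind hij).comp hg.measurable hg.measurable) hg₀ N⟩
  exact ((memLp_sampleAvg (fun i => (hid_g i).memLp_iff.2 hg₂) N).integrable
    (by norm_num)).norm.const_mul _

lemma tendstoInMeasure_sqrt_mul_inner_tikhonovSol_sub_sub (hlam : 0 < lam) (hV : MemLp (V 0) 2 μ)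
    (hm : μ[V 0] = m) (hS : covOp (V 0) μ = S)
    (hF : MemLp (fun ω => tikhonovInfluence S m (tikhonovSol S lam m) (V 0 ω)) 2 μ)
    (hid : ∀ i, IdentDistrib (V i) (V 0) μ μ) (hind : Pairwise fun i j => IndepFun (V i) (V j) μ)
    (φ : H) :
    TendstoInMeasure μ (fun (N : ℕ) ω => √(N : ℝ) *
      (inner ℝ (tikhonovSol (sampleCov N fun i => V i ω) lam (sampleAvg N fun i => V i ω)
          - tikhonovSol S lam m) φ
        - inner ℝ (sampleAvg N fun i => tikhonovInfluence S m (tikhonovSol S lam m) (V i ω))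
          (tikhonovSol S lam φ))) atTop 0 := by
  subst hm hS
  set m := μ[V 0]
  set S := covOp (V 0) μ
  set h := tikhonovSol S lam m
  have hcentered : ∫ ω, (V 0 ω - m) ∂μ = 0 := by
    rw [integral_sub (hV.integrable (by norm_num)) (integrable_const _), integral_const,
      probReal_univ, one_smul, sub_self]
  obtain ⟨hmean, Cₘ, hCₘ⟩ := exists_integral_sqrt_mul_norm_sampleAvg_comp_le hid hind
    (g := fun x => x - m) (by fun_prop) (hV.sub (memLp_const m)) hcentered
  obtain ⟨hinfl, Cᵢ, hCᵢ⟩ := exists_integral_sqrt_mul_norm_sampleAvg_comp_le hid hind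
    (continuous_tikhonovInfluence S m h) hF (integral_tikhonovInfluence_covOp hV h)
  have hfactor := tendstoInMeasure_comp_sampleAvg_sampleCov hV hid hind
    (f := fun a T => ‖tikhonovSol S lam φ‖ *
      (‖a - m‖ * ‖h‖ + lam⁻¹ * (1 + ‖a - m‖ * ‖h‖) * ‖T - S‖))
    (by unfold Function.uncurry; fun_prop) (by simp [S, m])
  refine tendstoInMeasure_zero_of_norm_le_mul (C := Cₘ + Cᵢ)
    (A := fun (N : ℕ) ω => √(N : ℝ) * ‖sampleAvg N fun i => V i ω - m‖
      + √(N : ℝ) * ‖sampleAvg N fun i => tikhonovInfluence S m h (V i ω)‖)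
    (fun N ω => by positivity) (fun N => (hmean N).add (hinfl N)) (fun N => ?_)
    (fun N ω => by positivity) hfactor ?_
  · rw [integral_add (hmean N) (hinfl N)]
    exact add_le_add (hCₘ N) (hCᵢ N)
  · filter_upwards [eventually_ne_atTop 0] with N hN ω
    rw [sampleAvg_sub_const hN, ← mul_add, mul_assoc, norm_mul,
      Real.norm_of_nonneg (Real.sqrt_nonneg _)]
    gcongr
    exact abs_inner_tikhonovSol_sampleCov_sub_sub_le (isPositive_covOp hV) hlam m φ hN _

theorem tendstoInDistribution_sqrt_mul_inner_tikhonovSol_sub (hlam : 0 < lam)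
    (hV : MemLp (V 0) 2 μ) (hm : μ[V 0] = m) (hS : covOp (V 0) μ = S)
    (hF : MemLp (fun ω => tikhonovInfluence S m (tikhonovSol S lam m) (V 0 ω)) 2 μ)
    (hid : ∀ i, IdentDistrib (V i) (V 0) μ μ) (hind : iIndepFun V μ) (φ : H) :
    TendstoInDistribution (fun (N : ℕ) ω => √(N : ℝ) *
      (inner ℝ (tikhonovSol (sampleCov N fun i => V i ω) lam (sampleAvg N fun i => V i ω)
        - tikhonovSol S lam m) φ : ℝ)) atTop id (fun _ => μ)
      (gaussianReal 0 (∫ ω, inner ℝ (tikhonovInfluence S m (tikhonovSol S lam m) (V 0 ω))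
        (tikhonovSol S lam φ) ^ 2 ∂μ).toNNReal) := by
  have hVi (i : ℕ) : AEStronglyMeasurable (V i) μ := ((hid i).memLp_iff.2 hV).1
  have hinfl := (continuous_tikhonovInfluence S m (tikhonovSol S lam m)).measurable
  have hF₀ : ∫ ω, tikhonovInfluence S m (tikhonovSol S lam m) (V 0 ω) ∂μ = 0 :=
    hm ▸ hS ▸ integral_tikhonovInfluence_covOp hV _
  refine tendstoInDistribution_of_tendstoInMeasure_sub _ _
    (tendstoInDistribution_sqrt_mul_inner_sampleAvg hF (fun i => (hid i).comp hinfl)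
      (hind.comp _ fun _ => hinfl) hF₀ (tikhonovSol S lam φ)) ?_ fun N => ?_
  · convert tendstoInMeasure_sqrt_mul_inner_tikhonovSol_sub_sub hlam hV hm hS hF hid
      (fun _ _ hij => hind.indepFun hij) φ using 3 with N ω
    exact (mul_sub _ _ _).symm
  · exact ((((aestronglyMeasurable_tikhonovSol_sampleCov hVi hlam N).sub
      aestronglyMeasurable_const).inner aestronglyMeasurable_const).const_mul _).aemeasurable

end IID

/-! ### The population and the empirical problem -/

section Problem

variable {d s : ℕ} {X : Set (EuclideanSpace ℝ (Fin d))} {Y : Set ℝ} {H : Type*}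
  [NormedAddCommGroup H] [InnerProductSpace ℝ H] [CompleteSpace H] [RKHS ℝ H X ℝ]
  {w : (Fin d → ℕ) → X × Y → ℝ} {P : Measure (X × Y)} {lam : ℝ} {n : ℕ} {α : Fin d → ℕ}
  {ξ : Fin n → X}

lemma empObjective_eq_tikhonovObjective (hX : X ⊆ closure (interior X))
    (hK : IsCk (2 * s) (kernProd (X := X) H)) (N : ℕ) (z : ℕ → X × Y) :
    (empObjective s w N z lam : H → ℝ)
      = tikhonovObjective (sampleCov N fun i => psi H s w (z i)) lam
        (sampleAvg N fun i => psi H s w (z i)) := by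
  ext h
  simp only [empObjective, tikhonovObjective, target_eq_inner hX hK, inner_sampleAvg,
    sampleVar_inner]

lemma hEmp_eq_tikhonovSol (hX : X ⊆ closure (interior X)) (hK : IsCk (2 * s) (kernProd (X := X) H))
    (hlam : 0 < lam) (N : ℕ) (z : ℕ → X × Y) :
    hEmp H s w N z lam = tikhonovSol (sampleCov N fun i => psi H s w (z i)) lam
      (sampleAvg N fun i => psi H s w (z i)) := by
  rw [hEmp, empObjective_eq_tikhonovObjective hX hK,
    argmin_tikhonovObjective (isPositive_sampleCov N _) hlam]

lemma inner_gridEval_sub (hX : X ⊆ closure (interior X))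
    (hK : IsCk (2 * s) (kernProd (X := X) H)) (hα : α ∈ multiIdx d s) (a b : H)
    (t : EuclideanSpace ℝ (Fin n)) :
    (inner ℝ (gridEval α ξ a - gridEval α ξ b) t : ℝ)
      = inner ℝ (a - b) (∑ j, t j • featDeriv H α (ξ j)) := by
  rw [PiLp.inner_apply, inner_sum]
  refine Finset.sum_congr rfl fun j _ => ?_
  simp [gridEval, D_eq_inner_featDeriv hX hK hα, inner_smul_right, inner_sub_left]

lemma dotProduct_omegaMat_mulVec (t : Fin n → ℝ) :
    t ⬝ᵥ (omegaMat H s w P lam α ξ).mulVec t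
      = inner ℝ (∑ k, t k • uVec H s w P lam α ξ k)
        (Q H s w P lam (∑ j, t j • uVec H s w P lam α ξ j)) := by
  simp only [dotProduct, Matrix.mulVec, omegaMat, Matrix.of_apply, map_sum, map_smul, sum_inner,
    inner_sum, real_inner_smul_left, inner_smul_right, Finset.mul_sum]
  rw [Finset.sum_comm]
  exact Finset.sum_congr rfl fun k _ => Finset.sum_congr rfl fun j _ => by ring

lemma sum_smul_uVec (t : Fin n → ℝ) : ∑ j, t j • uVec H s w P lam α ξ j
    = tikhonovSol (covPsi H s w P) lam (∑ j, t j • featDeriv H α (ξ j)) := by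
  simp only [tikhonovSol, map_sum, map_smul]
  rfl

theorem posSemidef_omegaMat (hF : MemLp (influence H s w P lam) 2 P) :
    (omegaMat H s w P lam α ξ).PosSemidef := by
  have hQ : (Q H s w P lam).IsPositive := isPositive_integral_rankOne_self hF
  refine Matrix.PosSemidef.of_dotProduct_mulVec_nonneg ?_ fun t => ?_
  · ext k j
    simp only [Matrix.conjTranspose_apply, omegaMat, Matrix.of_apply, star_trivial]
    rw [← hQ.inner_left_eq_inner_right, real_inner_comm]
  · rw [star_trivial, dotProduct_omegaMat_mulVec]
    exact hQ.inner_nonneg_right _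

lemma memLp_four_of_integrable_norm_pow {T E : Type*} [MeasurableSpace T] {ν : Measure T}
    [NormedAddCommGroup E] {W : T → E} (hm : AEStronglyMeasurable W ν)
    (h : Integrable (fun z => ‖W z‖ ^ 4) ν) : MemLp W 4 ν := by
  refine (integrable_norm_rpow_iff hm (by norm_num) (by norm_num)).1 ?_
  simpa using h

variable [IsProbabilityMeasure P]

lemma popObjective_eq_tikhonovObjective (hX : X ⊆ closure (interior X))
    (hK : IsCk (2 * s) (kernProd (X := X) H)) (hψ : MemLp (psi H s w) 2 P) :
    (popObjective s w P lam : H → ℝ)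
      = tikhonovObjective (covPsi H s w P) lam (meanPsi H s w P) := by
  ext h
  have hmean : ∫ z, (inner ℝ h (psi H s w z) : ℝ) ∂P = inner ℝ h (meanPsi H s w P) :=
    integral_inner (hψ.integrable (by norm_num)) h
  rw [popObjective, funext (target_eq_inner hX hK h), hmean, variance_inner hψ]
  rfl

lemma isPositive_covPsi (hψ : MemLp (psi H s w) 2 P) : (covPsi H s w P).IsPositive :=
  isPositive_covOp hψ

lemma hPop_eq_tikhonovSol (hX : X ⊆ closure (interior X)) (hK : IsCk (2 * s) (kernProd (X := X) H))
    (hψ : MemLp (psi H s w) 2 P) (hlam : 0 < lam) :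
    hPop H s w P lam = tikhonovSol (covPsi H s w P) lam (meanPsi H s w P) := by
  rw [hPop, popObjective_eq_tikhonovObjective hX hK hψ,
    argmin_tikhonovObjective (isPositive_covPsi hψ) hlam]

lemma influence_eq_tikhonovInfluence (hX : X ⊆ closure (interior X))
    (hK : IsCk (2 * s) (kernProd (X := X) H)) (hψ : MemLp (psi H s w) 2 P) (hlam : 0 < lam) :
    influence H s w P lam = fun z => tikhonovInfluence (covPsi H s w P) (meanPsi H s w P)
      (tikhonovSol (covPsi H s w P) lam (meanPsi H s w P)) (psi H s w z) := by
  rw [← hPop_eq_tikhonovSol hX hK hψ hlam]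
  rfl

lemma memLp_influence (hψ : MemLp (psi H s w) 4 P) (lam : ℝ) :
    MemLp (influence H s w P lam) 2 P :=
  memLp_tikhonovInfluence hψ _ _ _

end Problem

section Asymptotic

variable {d s : ℕ} {X : Set (EuclideanSpace ℝ (Fin d))} {Y : Set ℝ} {H : Type*}
  [NormedAddCommGroup H] [InnerProductSpace ℝ H] [CompleteSpace H] [RKHS ℝ H X ℝ]
  {w : (Fin d → ℕ) → X × Y → ℝ} {P : Measure (X × Y)} {lam : ℝ} {n : ℕ} {α : Fin d → ℕ}
  {ξ : Fin n → X} [IsProbabilityMeasure P] {Ω : Type*} [MeasurableSpace Ω] {μ : Measure Ω}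

lemma dotProduct_omegaMat_mulVec_eq_integral (hX : X ⊆ closure (interior X))
    (hK : IsCk (2 * s) (kernProd (X := X) H)) (hψ : MemLp (psi H s w) 2 P)
    (hF : MemLp (influence H s w P lam) 2 P) (hlam : 0 < lam) {Z : Ω → X × Y}
    (hZ : HasLaw Z P μ) (t : Fin n → ℝ) :
    t ⬝ᵥ (omegaMat H s w P lam α ξ).mulVec t
      = ∫ ω, inner ℝ (tikhonovInfluence (covPsi H s w P) (meanPsi H s w P)
          (tikhonovSol (covPsi H s w P) lam (meanPsi H s w P)) (psi H s w (Z ω)))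
        (tikhonovSol (covPsi H s w P) lam (∑ j, t j • featDeriv H α (ξ j))) ^ 2 ∂μ := by
  rw [dotProduct_omegaMat_mulVec, sum_smul_uVec, Q, inner_integral_rankOne_self_apply hF]
  rw [influence_eq_tikhonovInfluence hX hK hψ hlam] at hF ⊢
  simp only [← sq, real_inner_comm (tikhonovSol _ _ _)]
  exact (hZ.integral_comp ((hF.1.const_inner (𝕜 := ℝ)).pow 2)).symm

variable {Z : ℕ → Ω → X × Y}

lemma aemeasurable_gridEval_hEmp (hX : X ⊆ closure (interior X))
    (hK : IsCk (2 * s) (kernProd (X := X) H)) (hlam : 0 < lam)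
    (hψ : ∀ i, AEStronglyMeasurable (fun ω => psi H s w (Z i ω)) μ) (hα : α ∈ multiIdx d s)
    (N : ℕ) : AEMeasurable (fun ω => gridEval α ξ (hEmp H s w N (fun i => Z i ω) lam)) μ := by
  refine (WithLp.measurable_toLp 2 _).comp_aemeasurable (aemeasurable_pi_lambda _ fun j => ?_)
  simp only [D_eq_inner_featDeriv hX hK hα, hEmp_eq_tikhonovSol hX hK hlam]
  exact ((aestronglyMeasurable_tikhonovSol_sampleCov hψ hlam N).inner
    aestronglyMeasurable_const).aemeasurable

variable [IsProbabilityMeasure μ] [MeasurableSpace H] [BorelSpace H]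

theorem tendstoInDistribution_gridEval (hX : X ⊆ closure (interior X))
    (hK : IsCk (2 * s) (kernProd (X := X) H)) (hψ : MemLp (psi H s w) 2 P)
    (hF : MemLp (influence H s w P lam) 2 P) (hlam : 0 < lam) (hZ : ∀ i, HasLaw (Z i) P μ)
    (hindep : iIndepFun (fun i ω => psi H s w (Z i ω)) μ) (hα : α ∈ multiIdx d s) :
    TendstoInDistribution
      (fun (N : ℕ) (ω : Ω) => √(N : ℝ) •
        (gridEval α ξ (hEmp H s w N (fun i => Z i ω) lam) - gridEval α ξ (hPop H s w P lam)))
      atTop (id : EuclideanSpace ℝ (Fin n) → EuclideanSpace ℝ (Fin n)) (fun _ => μ)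
      (multivariateGaussian 0 (omegaMat H s w P lam α ξ)) := by
  have hψZ (i : ℕ) : MemLp (fun ω => psi H s w (Z i ω)) 2 μ := memLp_comp_hasLaw (hZ i) hψ
  have hid (i : ℕ) :
      IdentDistrib (fun ω => psi H s w (Z i ω)) (fun ω => psi H s w (Z 0 ω)) μ μ :=
    ((hZ i).identDistrib (hZ 0)).comp_of_aemeasurable (u := psi H s w)
      ((hZ i).map_eq.symm ▸ hψ.1.aemeasurable)
  have hsol := hPop_eq_tikhonovSol hX hK hψ hlam
  have hmean : ∫ ω, psi H s w (Z 0 ω) ∂μ = meanPsi H s w P := (hZ 0).integral_comp hψ.1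
  have hF₀ := memLp_comp_hasLaw (hZ 0) hF
  simp only [influence_eq_tikhonovInfluence hX hK hψ hlam] at hF₀
  refine tendstoInDistribution_multivariateGaussian_of_inner (fun N => ?_)
    (posSemidef_omegaMat hF) fun t => ?_
  · exact ((aemeasurable_gridEval_hEmp hX hK hlam (fun i => (hψZ i).1) hα N).sub_const
      (gridEval α ξ (hPop H s w P lam))).const_smul √(N : ℝ)
  · rw [dotProduct_omegaMat_mulVec_eq_integral hX hK hψ hF hlam (hZ 0)]
    refine (tendstoInDistribution_sqrt_mul_inner_tikhonovSol_sub
      (V := fun i ω => psi H s w (Z i ω)) (S := covPsi H s w P) hlam (hψZ 0) hmean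
      (covOp_comp_hasLaw (hZ 0) hψ.1) hF₀ hid hindep
      (∑ j, t j • featDeriv H α (ξ j))).congr (fun N => ae_of_all _ fun ω => ?_) .rfl
    simp only
    rw [real_inner_smul_left, inner_gridEval_sub hX hK hα, hEmp_eq_tikhonovSol hX hK hlam, hsol]

end Asymptotic

end MeanVar

theorem mainTheorem4_general
    {d s : ℕ} {X : Set (EuclideanSpace ℝ (Fin d))} {Y : Set ℝ}
    (hX : X ⊆ closure (interior X))
    {H : Type*} [NormedAddCommGroup H] [InnerProductSpace ℝ H] [CompleteSpace H] [RKHS ℝ H X ℝ]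
    [MeasurableSpace H] [BorelSpace H]
    (hK : MeanVar.IsCk (2 * s) (MeanVar.kernProd (X := X) H))
    (w : (Fin d → ℕ) → X × Y → ℝ)
    (P : Measure (X × Y)) [IsProbabilityMeasure P]
    (hψ : MemLp (MeanVar.psi H s w) 2 P)
    {lam : ℝ} (hlam : 0 < lam) (hF : MemLp (MeanVar.influence H s w P lam) 2 P)
    {S : Type*} [MeasurableSpace S] (μ : Measure S) [IsProbabilityMeasure μ]
    (Z : ℕ → S → X × Y) (hZ : ∀ i, HasLaw (Z i) P μ)
    (hindep : iIndepFun (fun i ω => MeanVar.psi H s w (Z i ω)) μ)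
    (α : Fin d → ℕ) (hα : α ∈ MeanVar.multiIdx d s) {n : ℕ} (ξ : Fin n → X) :
    (∀ h : H, MeanVar.IsCk s (fun x : X => h x)) ∧
    (∀ β ∈ MeanVar.multiIdx d s, ∀ x : X,
      (∀ y : X, MeanVar.featDeriv H β x y = MeanVar.D β (fun x' : X => MeanVar.kern H x' y) x) ∧
      ∀ h : H, MeanVar.D β (fun x' : X => h x') x = inner ℝ h (MeanVar.featDeriv H β x)) ∧
    (∃! h : H, ∀ g : H, MeanVar.popObjective s w P lam h ≤ MeanVar.popObjective s w P lam g) ∧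
    (∀ (N : ℕ) (ω : S), ∃! h : H, ∀ g : H,
      MeanVar.empObjective s w N (fun i => Z i ω) lam h
        ≤ MeanVar.empObjective s w N (fun i => Z i ω) lam g) ∧
    (MeanVar.omegaMat H s w P lam α ξ).PosSemidef ∧
    TendstoInDistribution
      (fun (N : ℕ) (ω : S) => √(N : ℝ) •
        (MeanVar.gridEval α ξ (MeanVar.hEmp H s w N (fun i => Z i ω) lam)
          - MeanVar.gridEval α ξ (MeanVar.hPop H s w P lam)))
      atTop
      (id : EuclideanSpace ℝ (Fin n) → EuclideanSpace ℝ (Fin n))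
      (fun _ => μ)
      (multivariateGaussian 0 (MeanVar.omegaMat H s w P lam α ξ)) :=
  ⟨MeanVar.isCk_coe hX hK,
    fun β hβ x => ⟨MeanVar.featDeriv_apply hX hK hβ x,
      fun h => MeanVar.D_eq_inner_featDeriv hX hK hβ h x⟩,
    by
      rw [MeanVar.popObjective_eq_tikhonovObjective hX hK hψ]
      exact MeanVar.existsUnique_forall_tikhonovObjective_le (MeanVar.isPositive_covPsi hψ) hlam _,
    fun N ω => by
      rw [MeanVar.empObjective_eq_tikhonovObjective hX hK]
      exact MeanVar.existsUnique_forall_tikhonovObjective_le (MeanVar.isPositive_sampleCov N _)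
        hlam _,
    MeanVar.posSemidef_omegaMat hF,
    MeanVar.tendstoInDistribution_gridEval hX hK hψ hF hlam hZ hindep hα⟩

theorem mainTheorem4
    -- the domain, the reproducing kernel Hilbert space and the smoothness of its kernel
    {d s : ℕ} {X : Set (EuclideanSpace ℝ (Fin d))} {Y : Set ℝ}
    (hX : X ⊆ closure (interior X))
    {H : Type*} [NormedAddCommGroup H] [InnerProductSpace ℝ H] [CompleteSpace H] [RKHS ℝ H X ℝ]
    [MeasurableSpace H] [BorelSpace H]
    (hK : MeanVar.IsCk (2 * s) (MeanVar.kernProd (X := X) H))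
    -- the weights and the population distribution, with the fourth moment assumption
    (w : (Fin d → ℕ) → X × Y → ℝ) (hw : ∀ β ∈ MeanVar.multiIdx d s, Measurable (w β))
    (P : Measure (X × Y)) [IsProbabilityMeasure P]
    (hP : Integrable (fun z => ‖MeanVar.psi H s w z‖ ^ 4) P)
    {lam : ℝ} (hlam : 0 < lam)
    -- the observations
    {S : Type*} [MeasurableSpace S] (μ : Measure S) [IsProbabilityMeasure μ]
    (Z : ℕ → S → X × Y) (hZ : ∀ i, HasLaw (Z i) P μ)
    (hindep : iIndepFun (fun i ω => MeanVar.psi H s w (Z i ω)) μ)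
    -- the derivative order and the grid
    (α : Fin d → ℕ) (hα : α ∈ MeanVar.multiIdx d s) {n : ℕ} (ξ : Fin n → X) :
    -- the objects are well defined
    (∀ h : H, MeanVar.IsCk s (fun x : X => h x)) ∧
    (∀ β ∈ MeanVar.multiIdx d s, ∀ x : X,
      (∀ y : X, MeanVar.featDeriv H β x y = MeanVar.D β (fun x' : X => MeanVar.kern H x' y) x) ∧
      ∀ h : H, MeanVar.D β (fun x' : X => h x') x = inner ℝ h (MeanVar.featDeriv H β x)) ∧
    (∃! h : H, ∀ g : H, MeanVar.popObjective s w P lam h ≤ MeanVar.popObjective s w P lam g) ∧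
    (∀ (N : ℕ) (ω : S), ∃! h : H, ∀ g : H,
      MeanVar.empObjective s w N (fun i => Z i ω) lam h
        ≤ MeanVar.empObjective s w N (fun i => Z i ω) lam g) ∧
    (MeanVar.omegaMat H s w P lam α ξ).PosSemidef ∧
    -- the asymptotic distribution
    TendstoInDistribution
      (fun (N : ℕ) (ω : S) => √(N : ℝ) •
        (MeanVar.gridEval α ξ (MeanVar.hEmp H s w N (fun i => Z i ω) lam)
          - MeanVar.gridEval α ξ (MeanVar.hPop H s w P lam)))
      atTop
      (id : EuclideanSpace ℝ (Fin n) → EuclideanSpace ℝ (Fin n))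
      (fun _ => μ)
      (multivariateGaussian 0 (MeanVar.omegaMat H s w P lam α ξ)) := by
  have hψ := MeanVar.memLp_four_of_integrable_norm_pow
    (MeanVar.stronglyMeasurable_psi (H := H) (Y := Y) hX hK hw).aestronglyMeasurable hP
  exact mainTheorem4_general hX hK w P (hψ.mono_exponent (by norm_num)) hlam
    (MeanVar.memLp_influence hψ lam) μ Z hZ hindep α hα ξ
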